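/- Let $X$ be the graph with vertex set $\mathbb{Z}^2$ in which two vertices are joined by an edge if and only if their $\ell_1$-distance is $1$. For $A\subset\mathbb{Z}^2$ let $\partial A$ be the set of vertices not in $A$ that are adjacent to a vertex of $A$. A finite set $A\subset\mathbb{Z}^2$ is minimal if $|\partial A|\le|\partial B|$ for every $B\subset\mathbb{Z}^2$ with $|B|=|A|$. The excess of a finite set $A$ is $$\operatorname{Exc}(A)=\max\{\,|A|-|B| \;:\; B\subset\mathbb{Z}^2 \text{ is minimal and } |\partial A|=|\partial B|\,\}\in\mathbb{Z}.$$ A box is a nonempty set of the form $\{(x,y)\in\mathbb{Z}^2 : a\le y-x\le b,\ c\le y+x\le d\}$ with $a,b,c,d\in\mathbb{Z}$, and the enclosing box $\operatorname{enc}(A)$ of a finite nonempty set $A$ is the smallest box containing $A$. A cone is the image of $\{(x,y)\in\mathbb{Z}^2 : y-x\ge 0,\ y+x\ge 0\}$ under a graph automorphism of $X$. Let $A$ be a finite nonempty subset of $\mathbb{Z}^2$, let $N=|\operatorname{enc}(A)\setminus A|$ and $E=\operatorname{Exc}(\operatorname{enc}(A))$. Then the maximum defining $E$ exists, and the following are equivalent: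 1. $A$ is minimal; 2. $|\partial A|=|\partial(\operatorname{enc}(A))|$ and $N\le E$; 3. $\mathbb{Z}^2\setminus A$ is a union of cones and $N\le E$. -/

import Mathlib

namespace LatticeIso

/-- The outer vertex boundary of a set `S` of vertices of a graph. -/
def boundary {V : Type*} (G : SimpleGraph V) (S : Set V) : Set V :=
  {u | u ∉ S ∧ ∃ v ∈ S, G.Adj u v}

/-- Two sets of vertices are congruent if a graph automorphism maps one onto the other. -/
def Congruent {V : Type*} (G : SimpleGraph V) (S T : Set V) : Prop :=
  ∃ φ : G ≃g G, φ '' S = T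

/-- The graph on `ℤ × ℤ` joining the pairs of vertices at `ℓ¹`-distance one. -/
def lattice : SimpleGraph (ℤ × ℤ) where
  Adj p q := |p.1 - q.1| + |p.2 - q.2| = 1
  symm := ⟨fun p q h => by rw [abs_sub_comm q.1, abs_sub_comm q.2]; exact h⟩
  loopless := ⟨fun p h => by simp at h⟩

/-- A finite set is minimal if its boundary is smallest among all sets with equally many
vertices. -/
def IsMinimal (A : Set (ℤ × ℤ)) : Prop :=
  A.Finite ∧ ∀ B : Set (ℤ × ℤ), B.Finite → B.ncard = A.ncard →
    (boundary lattice A).ncard ≤ (boundary lattice B).ncard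

/-- The integers `|A| - |B|`, over all minimal sets `B` with `|∂A| = |∂B|`. -/
def excessSet (A : Set (ℤ × ℤ)) : Set ℤ :=
  {k | ∃ B : Set (ℤ × ℤ), IsMinimal B ∧
    (boundary lattice A).ncard = (boundary lattice B).ncard ∧
    k = (A.ncard : ℤ) - (B.ncard : ℤ)}

/-- The excess of `A`, i.e. the maximum of `excessSet A`. -/
noncomputable def excess (A : Set (ℤ × ℤ)) : ℤ :=
  sSup (excessSet A)

/-- The vertices `(x, y)` with `a ≤ y - x ≤ b` and `c ≤ y + x ≤ d`. -/
def box (a b c d : ℤ) : Set (ℤ × ℤ) :=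
  {p | (a ≤ p.2 - p.1 ∧ p.2 - p.1 ≤ b) ∧ (c ≤ p.2 + p.1 ∧ p.2 + p.1 ≤ d)}

/-- A box is a nonempty set bounded by lines of slope `1` and `-1`. -/
def IsBox (S : Set (ℤ × ℤ)) : Prop :=
  S.Nonempty ∧ ∃ a b c d : ℤ, S = box a b c d

/-- The enclosing box, as the intersection of all boxes containing `A`. For `A` finite and
nonempty, `isLeast_enc` shows that it is the smallest box containing `A`. -/
def enc (A : Set (ℤ × ℤ)) : Set (ℤ × ℤ) :=
  ⋂₀ {S | IsBox S ∧ A ⊆ S}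

/-- The upward cone at the origin. -/
def standardCone : Set (ℤ × ℤ) :=
  {p | 0 ≤ p.2 - p.1 ∧ 0 ≤ p.2 + p.1}

/-- A cone is a set congruent to the upward cone at the origin. -/
def IsCone (C : Set (ℤ × ℤ)) : Prop :=
  Congruent lattice standardCone C

/-- `S` is a union of cones. -/
def IsUnionOfCones (S : Set (ℤ × ℤ)) : Prop :=
  ∃ F : Set (Set (ℤ × ℤ)), (∀ C ∈ F, IsCone C) ∧ S = ⋃₀ F

theorem isLeast_enc {A : Set (ℤ × ℤ)} (hA : A.Finite) (hne : A.Nonempty) :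
    IsLeast {S | IsBox S ∧ A ⊆ S} (enc A) := by
  obtain ⟨p, hp, hpm⟩ := Set.exists_min_image A (fun q => q.2 - q.1) hA hne
  obtain ⟨q, hq, hqm⟩ := Set.exists_max_image A (fun q => q.2 - q.1) hA hne
  obtain ⟨r, hr, hrm⟩ := Set.exists_min_image A (fun q => q.2 + q.1) hA hne
  obtain ⟨s, hs, hsm⟩ := Set.exists_max_image A (fun q => q.2 + q.1) hA hne
  have hsub : A ⊆ box (p.2 - p.1) (q.2 - q.1) (r.2 + r.1) (s.2 + s.1) :=
    fun v hv => ⟨⟨hpm v hv, hqm v hv⟩, ⟨hrm v hv, hsm v hv⟩⟩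
  have hbox : IsBox (box (p.2 - p.1) (q.2 - q.1) (r.2 + r.1) (s.2 + s.1)) :=
    ⟨hne.mono hsub, _, _, _, _, rfl⟩
  have henc : enc A = box (p.2 - p.1) (q.2 - q.1) (r.2 + r.1) (s.2 + s.1) := by
    apply Set.Subset.antisymm
    · exact Set.sInter_subset_of_mem ⟨hbox, hsub⟩
    · rintro v ⟨⟨h1, h2⟩, h3, h4⟩ S ⟨⟨-, a, b, c, d, rfl⟩, hAS⟩
      exact ⟨⟨(hAS hp).1.1.trans h1, h2.trans (hAS hq).1.2⟩,
        ⟨(hAS hr).2.1.trans h3, h4.trans (hAS hs).2.2⟩⟩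
  refine ⟨?_, fun S hS => Set.sInter_subset_of_mem hS⟩
  rw [henc]
  exact ⟨hbox, hsub⟩

end LatticeIso

namespace LatticeIso

/-! Write `u = y - x` and `v = y + x`; a box is a rectangle in `(u, v)`, and its boundary has at
most `(range of u) + (range of v) + 4` points. The main step is that a nonempty minimal `A` has at
least this many boundary points, with the ranges taken over `A`. Four points of `A` extremal for `u`
and `v` delimit four sides, each giving one boundary point per row or column, and the side lengths
add up to exactly this number. That no row is missed and no point is counted twice follows from a
quadrant lemma: if two perpendicular rays from a point miss a minimal set that meets the quadrant
between them, then the whole set lies in that quadrant, since otherwise sliding the quadrant part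
diagonally would increase the overlap of closed neighbourhoods and so shrink the boundary. Minimal
boundary size is monotone in cardinality, so `|∂A| ≤ |∂(enc A)|`; all these bounds are therefore
equalities, and `∂A` consists of the four sides only. This yields 1 → 2, because `A` itself then
competes in the maximum defining `E`.

Conversely, let `B` be a minimal set attaining `E`. Then `N ≤ E` says `|B| ≤ |A|`, so `|∂A| ≤ |∂(enc
A)| = |∂B|` makes `A` minimal. Under 3 this inequality comes from pushing boundary points
injectively along free cones to the border of the box.

For 1 → 3, each side point of a minimal set is the apex of a cone missing it. Hence `A` has the same
boundary as its cone hull, and a point of the hull outside `A` would force an impossible pinwheel of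
boundary points around it. -/

/-! ### Boundaries, closed neighbourhoods and symmetries -/

theorem adj_iff (p q : ℤ × ℤ) : lattice.Adj p q ↔
    q = (p.1 + 1, p.2) ∨ q = (p.1 - 1, p.2) ∨ q = (p.1, p.2 + 1) ∨ q = (p.1, p.2 - 1) := by
  obtain ⟨a, b⟩ := p
  obtain ⟨c, d⟩ := q
  simp only [lattice, Prod.mk.injEq]
  rcases abs_cases (a - c) with h | h <;> rcases abs_cases (b - d) with h' | h' <;> omega

theorem mem_boundary {S : Set (ℤ × ℤ)} {x y : ℤ} : (x, y) ∈ boundary lattice S ↔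
    (x, y) ∉ S ∧ ((x + 1, y) ∈ S ∨ (x - 1, y) ∈ S ∨ (x, y + 1) ∈ S ∨ (x, y - 1) ∈ S) := by
  simp only [boundary, Set.mem_ofPred_eq, adj_iff]
  refine and_congr_right fun _ => ⟨?_, ?_⟩
  · rintro ⟨v, hv, rfl | rfl | rfl | rfl⟩ <;> simp [hv]
  · rintro (h | h | h | h) <;> exact ⟨_, h, by simp⟩

/-- The closed neighbourhood of a set of lattice points. -/
def nbhd (S : Set (ℤ × ℤ)) : Set (ℤ × ℤ) := S ∪ boundary lattice S

theorem mem_nbhd {S : Set (ℤ × ℤ)} {x y : ℤ} : (x, y) ∈ nbhd S ↔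
    (x, y) ∈ S ∨ (x + 1, y) ∈ S ∨ (x - 1, y) ∈ S ∨ (x, y + 1) ∈ S ∨ (x, y - 1) ∈ S := by
  rw [nbhd, Set.mem_union, mem_boundary]
  tauto

theorem nbhd_union (S T : Set (ℤ × ℤ)) : nbhd (S ∪ T) = nbhd S ∪ nbhd T := by
  ext ⟨x, y⟩
  simp only [Set.mem_union, mem_nbhd]
  tauto

theorem finite_boundary {S : Set (ℤ × ℤ)} (hS : S.Finite) : (boundary lattice S).Finite := by
  refine ((((hS.image fun p => (p.1 - 1, p.2)).union (hS.image fun p => (p.1 + 1, p.2))).union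
    (hS.image fun p => (p.1, p.2 - 1))).union (hS.image fun p => (p.1, p.2 + 1))).subset ?_
  rintro ⟨x, y⟩ h
  obtain ⟨-, h | h | h | h⟩ := mem_boundary.1 h
  · exact .inl (.inl (.inl ⟨_, h, by simp⟩))
  · exact .inl (.inl (.inr ⟨_, h, by simp⟩))
  · exact .inl (.inr ⟨_, h, by simp⟩)
  · exact .inr ⟨_, h, by simp⟩

theorem finite_nbhd {S : Set (ℤ × ℤ)} (hS : S.Finite) : (nbhd S).Finite :=
  hS.union (finite_boundary hS)

theorem ncard_nbhd {S : Set (ℤ × ℤ)} (hS : S.Finite) :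
    (nbhd S).ncard = S.ncard + (boundary lattice S).ncard :=
  Set.ncard_union_eq (Set.disjoint_left.2 fun _ h h' => h'.1 h) hS (finite_boundary hS)

theorem boundary_image (φ : lattice ≃g lattice) (S : Set (ℤ × ℤ)) :
    boundary lattice (φ '' S) = φ '' boundary lattice S := by
  ext u
  obtain ⟨u, rfl⟩ := φ.surjective u
  rw [φ.injective.mem_set_image]
  simp only [boundary, Set.mem_ofPred_eq, φ.injective.mem_set_image, Set.exists_mem_image,
    φ.map_adj_iff]

theorem ncard_boundary_image (φ : lattice ≃g lattice) (S : Set (ℤ × ℤ)) :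
    (boundary lattice (φ '' S)).ncard = (boundary lattice S).ncard := by
  rw [boundary_image, Set.ncard_image_of_injective _ φ.injective]

theorem IsMinimal.image {A : Set (ℤ × ℤ)} (hA : IsMinimal A) (φ : lattice ≃g lattice) :
    IsMinimal (φ '' A) := by
  refine ⟨hA.1.image _, fun B hB h => ?_⟩
  rw [ncard_boundary_image]
  rw [Set.ncard_image_of_injective _ φ.injective] at h
  exact hA.2 B hB h

/-- The translation by `t`. -/
def translation (t : ℤ × ℤ) : lattice ≃g lattice where
  toEquiv := Equiv.addRight t
  map_rel_iff' := by simp [lattice]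

/-- The reflection `(x, y) ↦ (-x, y)`. -/
def reflection : lattice ≃g lattice where
  toEquiv := (Equiv.neg ℤ).prodCongr (Equiv.refl ℤ)
  map_rel_iff' := by
    intro p q
    simp only [lattice, Equiv.prodCongr_apply, Prod.map, Equiv.neg_apply, Equiv.refl_apply]
    rw [show -p.1 - -q.1 = -(p.1 - q.1) by ring, abs_neg]

/-- The reflection `(x, y) ↦ (y, x)`. -/
def transposition : lattice ≃g lattice where
  toEquiv := Equiv.prodComm ℤ ℤ
  map_rel_iff' := by
    intro p q
    simp only [lattice, Equiv.prodComm_apply, Prod.fst_swap, Prod.snd_swap]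
    rw [add_comm]

theorem mem_translation_image {t : ℤ × ℤ} {S : Set (ℤ × ℤ)} {x y : ℤ} :
    (x, y) ∈ translation t '' S ↔ (x - t.1, y - t.2) ∈ S := by
  constructor
  · rintro ⟨⟨a, b⟩, h, h'⟩
    have : a + t.1 = x ∧ b + t.2 = y := Prod.mk.inj h'
    obtain ⟨rfl, rfl⟩ := this
    simpa using h
  · exact fun h => ⟨_, h, Prod.ext (sub_add_cancel _ _) (sub_add_cancel _ _)⟩

theorem mem_reflection_image {S : Set (ℤ × ℤ)} {x y : ℤ} :
    (x, y) ∈ reflection '' S ↔ (-x, y) ∈ S := by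
  constructor
  · rintro ⟨⟨a, b⟩, h, h'⟩
    have : -a = x ∧ b = y := Prod.mk.inj h'
    obtain ⟨rfl, rfl⟩ := this
    simpa using h
  · exact fun h => ⟨_, h, by simp [reflection]⟩

theorem mem_transposition_image {S : Set (ℤ × ℤ)} {x y : ℤ} :
    (x, y) ∈ transposition '' S ↔ (y, x) ∈ S := by
  constructor
  · rintro ⟨⟨a, b⟩, h, h'⟩
    have : b = x ∧ a = y := Prod.mk.inj h'
    obtain ⟨rfl, rfl⟩ := this
    exact h
  · exact fun h => ⟨_, h, by simp [transposition]⟩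

/-! ### Monotonicity of the minimal boundary size -/

/-- Delete a lowest point: the boundary gains at most that point and loses the point below it, which
had no other neighbour in `S`. -/
theorem exists_ncard_boundary_diff_singleton_le {S : Set (ℤ × ℤ)} (hS : S.Finite)
    (hne : S.Nonempty) :
    ∃ p ∈ S, (boundary lattice (S \ {p})).ncard ≤ (boundary lattice S).ncard := by
  obtain ⟨⟨x, y⟩, hp, hmin⟩ := Set.exists_min_image S (fun q => q.2) hS hne
  have low : ∀ a b, b < y → (a, b) ∉ S := fun a b hb h => by
    have := hmin _ h
    simp only at this
    omega
  refine ⟨(x, y), hp, ?_⟩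
  have hfin := finite_boundary hS
  have hmem : (x, y - 1) ∈ boundary lattice S :=
    mem_boundary.2 ⟨low _ _ (by omega), .inr (.inr (.inl (by simpa using hp)))⟩
  have hsub : boundary lattice (S \ {(x, y)}) ⊆
      insert (x, y) (boundary lattice S \ {(x, y - 1)}) := by
    rintro ⟨a, b⟩ h
    rw [mem_boundary] at h
    obtain ⟨h1, h2⟩ := h
    by_cases hab : (a, b) = (x, y)
    · exact .inl hab
    · refine .inr ⟨mem_boundary.2 ⟨fun h => h1 ⟨h, hab⟩, ?_⟩, ?_⟩
      · rcases h2 with h | h | h | h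
        · exact .inl h.1
        · exact .inr (.inl h.1)
        · exact .inr (.inr (.inl h.1))
        · exact .inr (.inr (.inr h.1))
      · rintro h
        obtain ⟨rfl, rfl⟩ := Prod.mk.inj h
        rcases h2 with h | h | h | h
        · exact low _ _ (by omega) h.1
        · exact low _ _ (by omega) h.1
        · exact h.2 (by simp)
        · exact low _ _ (by omega) h.1
  calc (boundary lattice (S \ {(x, y)})).ncard
      ≤ (insert (x, y) (boundary lattice S \ {(x, y - 1)})).ncard :=
        Set.ncard_le_ncard hsub ((hfin.subset Set.sdiff_subset).insert _)
    _ ≤ (boundary lattice S \ {(x, y - 1)}).ncard + 1 := Set.ncard_insert_le _ _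
    _ = (boundary lattice S).ncard := Set.ncard_sdiff_singleton_add_one hmem hfin

theorem exists_ncard_eq_of_le {S : Set (ℤ × ℤ)} (hS : S.Finite) {n : ℕ} (hn : n ≤ S.ncard) :
    ∃ T : Set (ℤ × ℤ), T.Finite ∧ T.ncard = n ∧
      (boundary lattice T).ncard ≤ (boundary lattice S).ncard := by
  obtain ⟨k, hk⟩ := Nat.exists_eq_add_of_le hn
  induction k generalizing S with
  | zero => exact ⟨S, hS, hk, le_rfl⟩
  | succ k ih =>
    have hne : S.Nonempty := by
      rw [← Set.ncard_pos hS]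
      omega
    obtain ⟨p, hp, hle⟩ := exists_ncard_boundary_diff_singleton_le hS hne
    have h1 := Set.ncard_sdiff_singleton_add_one hp hS
    obtain ⟨T, hT, hTn, hTle⟩ :=
      ih (hS.subset (Set.sdiff_subset (t := {p}))) (by omega) (by omega)
    exact ⟨T, hT, hTn, hTle.trans hle⟩

theorem IsMinimal.ncard_boundary_le {A B : Set (ℤ × ℤ)} (hA : IsMinimal A) (hB : B.Finite)
    (h : A.ncard ≤ B.ncard) : (boundary lattice A).ncard ≤ (boundary lattice B).ncard := by
  obtain ⟨T, hT, hTn, hTle⟩ := exists_ncard_eq_of_le hB h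
  exact (hA.2 T hT hTn).trans hTle

theorem IsMinimal.of_ncard_le {A B : Set (ℤ × ℤ)} (hB : IsMinimal B) (hA : A.Finite)
    (h : B.ncard ≤ A.ncard) (h' : (boundary lattice A).ncard ≤ (boundary lattice B).ncard) :
    IsMinimal A :=
  ⟨hA, fun _ hC hn => h'.trans (hB.ncard_boundary_le hC (by omega))⟩

theorem exists_isMinimal (n : ℕ) : ∃ A, IsMinimal A ∧ A.ncard = n := by
  obtain ⟨s, -, hs⟩ := (Set.infinite_univ (α := ℤ × ℤ)).exists_subset_card_eq n
  have hex : ∃ k, ∃ A : Set (ℤ × ℤ), A.Finite ∧ A.ncard = n ∧ (boundary lattice A).ncard = k :=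
    ⟨_, s, s.finite_toSet, by simpa using hs, rfl⟩
  classical
  obtain ⟨A, hA, hn, hk⟩ := Nat.find_spec hex
  refine ⟨A, ⟨hA, fun B hB h => ?_⟩, hn⟩
  rw [hk]
  exact Nat.find_min' hex ⟨B, hB, h.trans hn, rfl⟩

/-! ### Moving a piece of a minimal set; the quadrant lemma -/

/-- By inclusion-exclusion for closed neighbourhoods, moving one piece changes the boundary size
only through the overlap, so a larger overlap would beat minimality. -/
theorem IsMinimal.ncard_nbhd_inter_le {A₁ A₂ : Set (ℤ × ℤ)} (hA : IsMinimal (A₁ ∪ A₂))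
    (h : Disjoint A₁ A₂) {t : ℤ × ℤ} (ht : Disjoint (translation t '' A₁) A₂) :
    (nbhd (translation t '' A₁) ∩ nbhd A₂).ncard ≤ (nbhd A₁ ∩ nbhd A₂).ncard := by
  have h₁ : A₁.Finite := hA.1.subset Set.subset_union_left
  have h₂ : A₂.Finite := hA.1.subset Set.subset_union_right
  have ht₁ := h₁.image (translation t)
  have hcard : (translation t '' A₁).ncard = A₁.ncard :=
    Set.ncard_image_of_injective _ (translation t).injective
  have hb := ncard_boundary_image (translation t) A₁
  have e1 := Set.ncard_union_eq h h₁ h₂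
  have e2 := Set.ncard_union_eq ht ht₁ h₂
  have hle := hA.2 _ (ht₁.union h₂) (by omega)
  have e3 := Set.ncard_union_add_ncard_inter (nbhd A₁) (nbhd A₂) (finite_nbhd h₁) (finite_nbhd h₂)
  have e4 := Set.ncard_union_add_ncard_inter (nbhd (translation t '' A₁)) (nbhd A₂)
    (finite_nbhd ht₁) (finite_nbhd h₂)
  rw [← nbhd_union, ncard_nbhd hA.1, ncard_nbhd h₁, ncard_nbhd h₂] at e3
  rw [← nbhd_union, ncard_nbhd (ht₁.union h₂), ncard_nbhd ht₁, ncard_nbhd h₂] at e4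
  omega

/-- Placing a lowest point of `A₁` directly above a highest point of `A₂` keeps the pieces disjoint
and creates an overlap, so the original overlap was nonempty too. -/
theorem IsMinimal.nbhd_inter_nonempty {A₁ A₂ : Set (ℤ × ℤ)} (hA : IsMinimal (A₁ ∪ A₂))
    (h : Disjoint A₁ A₂) (hne₁ : A₁.Nonempty) (hne₂ : A₂.Nonempty) :
    (nbhd A₁ ∩ nbhd A₂).Nonempty := by
  have h₁ : A₁.Finite := hA.1.subset Set.subset_union_left
  have h₂ : A₂.Finite := hA.1.subset Set.subset_union_right
  obtain ⟨⟨a, b⟩, hp, hmin⟩ := Set.exists_min_image A₁ (fun q => q.2) h₁ hne₁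
  obtain ⟨⟨c, d⟩, hq, hmax⟩ := Set.exists_max_image A₂ (fun q => q.2) h₂ hne₂
  have hdisj : Disjoint (translation (c - a, d + 1 - b) '' A₁) A₂ := by
    rw [Set.disjoint_left]
    rintro ⟨x, y⟩ hx hy
    rw [mem_translation_image] at hx
    have h3 := hmin _ hx
    have h4 := hmax _ hy
    simp only at h3 h4
    omega
  have hle := hA.ncard_nbhd_inter_le h hdisj
  have hfin := (finite_nbhd h₁).inter_of_left (nbhd A₂)
  have hfin' := (finite_nbhd (h₁.image (translation (c - a, d + 1 - b)))).inter_of_left (nbhd A₂)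
  rw [← Set.ncard_pos hfin]
  refine lt_of_lt_of_le ?_ hle
  rw [Set.ncard_pos hfin']
  refine ⟨(c, d), mem_nbhd.2 (.inr (.inr (.inr (.inl ?_)))), mem_nbhd.2 (.inl hq)⟩
  rw [mem_translation_image]
  simpa using hp

/-- The quadrant lemma. If points of `A` lay on both sides of the two rays, shifting the quadrant
part by `(1, -1)` onto the rays would keep every overlap point and add a new one. -/
theorem IsMinimal.subset_upperLeft {A : Set (ℤ × ℤ)} (hA : IsMinimal A) {x₀ y₀ : ℤ}
    (hl : ∀ x ≤ x₀, (x, y₀) ∉ A) (hu : ∀ y, y₀ ≤ y → (x₀, y) ∉ A) {a b : ℤ} (hab : (a, b) ∈ A)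
    (ha : a ≤ x₀) (hb : y₀ ≤ b) {c d : ℤ} (hcd : (c, d) ∈ A) : c ≤ x₀ ∧ y₀ ≤ d := by
  by_contra hcon
  let Q : Set (ℤ × ℤ) := {p | p.1 ≤ x₀ ∧ y₀ ≤ p.2}
  have hmem₁ : ∀ {x y}, (x, y) ∈ A ∩ Q ↔ (x, y) ∈ A ∧ x ≤ x₀ ∧ y₀ ≤ y := Iff.rfl
  have hmem₂ : ∀ {x y}, (x, y) ∈ A \ Q ↔ (x, y) ∈ A ∧ ¬(x ≤ x₀ ∧ y₀ ≤ y) := Iff.rfl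
  have strict : ∀ {x y}, (x, y) ∈ A ∩ Q → x < x₀ ∧ y₀ < y := by
    intro x y h
    obtain ⟨h1, h2, h3⟩ := hmem₁.1 h
    refine ⟨lt_of_le_of_ne h2 ?_, lt_of_le_of_ne h3 ?_⟩
    · rintro rfl
      exact hu _ h3 h1
    · rintro rfl
      exact hl _ h2 h1
  have hunion : A ∩ Q ∪ A \ Q = A := Set.inter_union_sdiff _ _
  have hA' : IsMinimal (A ∩ Q ∪ A \ Q) := by rwa [hunion]
  have hdisj : Disjoint (A ∩ Q) (A \ Q) :=
    Set.disjoint_left.2 fun _ h h' => h'.2 h.2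
  obtain ⟨⟨x, y⟩, hx₁, hx₂⟩ := hA'.nbhd_inter_nonempty hdisj ⟨_, hab, ha, hb⟩ ⟨_, hcd, hcon⟩
  have hdisj' : Disjoint (translation (1, -1) '' (A ∩ Q)) (A \ Q) := by
    rw [Set.disjoint_left]
    rintro ⟨x, y⟩ h h'
    have := strict (mem_translation_image.1 h)
    have := (hmem₂.1 h').2
    simp only at *
    omega
  have hfin := (finite_nbhd (hA.1.subset Set.inter_subset_left)).inter_of_left
    (s := nbhd (A ∩ Q)) (nbhd (A \ Q))
  have hfin' := (finite_nbhd ((hA.1.subset Set.inter_subset_left).image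
    (translation (1, -1)))).inter_of_left (s := nbhd (translation (1, -1) '' (A ∩ Q)))
      (nbhd (A \ Q))
  -- the points of the overlap lie on the two rays
  have key : ∀ {x y}, (x, y) ∈ nbhd (A ∩ Q) ∩ nbhd (A \ Q) →
      (y = y₀ ∧ (x, y + 1) ∈ A ∩ Q ∧ (x, y - 1) ∈ A \ Q) ∨
      (x = x₀ ∧ (x - 1, y) ∈ A ∩ Q ∧ (x + 1, y) ∈ A \ Q) := by
    rintro x y ⟨h, h'⟩
    rw [mem_nbhd] at h h'
    rcases h with h | h | h | h | h <;> rcases h' with h' | h' | h' | h' | h' <;>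
      have h1 := strict h <;> have h2 := (hmem₂.1 h').2 <;>
      first
      | (exfalso; omega)
      | exact .inl ⟨by omega, h, h'⟩
      | exact .inr ⟨by omega, h, h'⟩
  have shift : ∀ {x y}, (x, y) ∈ A ∩ Q → (x + 1, y - 1) ∈ translation (1, -1) '' (A ∩ Q) :=
    fun h => mem_translation_image.2 (by simpa using h)
  have hsub : nbhd (A ∩ Q) ∩ nbhd (A \ Q) ⊆
      nbhd (translation (1, -1) '' (A ∩ Q)) ∩ nbhd (A \ Q) := by
    rintro ⟨x, y⟩ h
    refine ⟨?_, h.2⟩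
    rcases key h with ⟨-, h1, -⟩ | ⟨-, h1, -⟩
    · exact mem_nbhd.2 (.inr (.inl (by simpa using shift h1)))
    · exact mem_nbhd.2 (.inr (.inr (.inr (.inr (by simpa using shift h1)))))
  -- An overlap point `(x, y)` on either ray yields the new overlap point `(x + 1, y - 1)`, which
  -- lies strictly beyond that ray.
  obtain ⟨⟨x', y'⟩, hnew, hold⟩ : ∃ p, p ∈ nbhd (translation (1, -1) '' (A ∩ Q)) ∩ nbhd (A \ Q) ∧
      p ∉ nbhd (A ∩ Q) ∩ nbhd (A \ Q) := by
    rcases key ⟨hx₁, hx₂⟩ with ⟨h0, h1, h2⟩ | ⟨h0, h1, h2⟩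
    · refine ⟨(x + 1, y - 1), ⟨mem_nbhd.2 (.inr (.inr (.inr (.inl ?_)))),
        mem_nbhd.2 (.inr (.inr (.inl (by simpa using h2))))⟩, fun h => ?_⟩
      · simpa using shift h1
      · rcases key h with ⟨h3, -, -⟩ | ⟨-, h3, -⟩
        · omega
        · have := strict h3
          omega
    · refine ⟨(x + 1, y - 1), ⟨mem_nbhd.2 (.inr (.inr (.inl ?_))),
        mem_nbhd.2 (.inr (.inr (.inr (.inl (by simpa using h2)))))⟩, fun h => ?_⟩
      · simpa using shift h1
      · rcases key h with ⟨-, h3, -⟩ | ⟨h3, -, -⟩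
        · have := strict h3
          omega
        · omega
  have hlt := Set.ncard_lt_ncard (Set.ssubset_iff_of_subset hsub |>.2 ⟨_, hnew, hold⟩) hfin'
  exact absurd (hA'.ncard_nbhd_inter_le hdisj hdisj') (not_le.2 hlt)

theorem IsMinimal.subset_upperRight {A : Set (ℤ × ℤ)} (hA : IsMinimal A) {x₀ y₀ : ℤ}
    (hl : ∀ x, x₀ ≤ x → (x, y₀) ∉ A) (hu : ∀ y, y₀ ≤ y → (x₀, y) ∉ A) {a b : ℤ}
    (hab : (a, b) ∈ A) (ha : x₀ ≤ a) (hb : y₀ ≤ b) {c d : ℤ} (hcd : (c, d) ∈ A) :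
    x₀ ≤ c ∧ y₀ ≤ d := by
  have h := (hA.image reflection).subset_upperLeft (x₀ := -x₀) (y₀ := y₀) (a := -a) (b := b)
    (c := -c) (d := d) (fun x hx => by rw [mem_reflection_image]; exact hl _ (by omega))
    (fun y hy => by rw [mem_reflection_image, neg_neg]; exact hu _ hy)
    (by rwa [mem_reflection_image, neg_neg]) (by omega) hb
    (by rwa [mem_reflection_image, neg_neg])
  exact ⟨by omega, h.2⟩

theorem IsMinimal.subset_lowerRight {A : Set (ℤ × ℤ)} (hA : IsMinimal A) {x₀ y₀ : ℤ}
    (hl : ∀ x, x₀ ≤ x → (x, y₀) ∉ A) (hu : ∀ y ≤ y₀, (x₀, y) ∉ A) {a b : ℤ}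
    (hab : (a, b) ∈ A) (ha : x₀ ≤ a) (hb : b ≤ y₀) {c d : ℤ} (hcd : (c, d) ∈ A) :
    x₀ ≤ c ∧ d ≤ y₀ := by
  have h := (hA.image transposition).subset_upperLeft (x₀ := y₀) (y₀ := x₀) (a := b) (b := a)
    (c := d) (d := c) (fun x hx => by rw [mem_transposition_image]; exact hu _ hx)
    (fun y hy => by rw [mem_transposition_image]; exact hl _ hy)
    (by rwa [mem_transposition_image]) hb ha (by rwa [mem_transposition_image])
  exact ⟨h.2, h.1⟩

theorem IsMinimal.subset_lowerLeft {A : Set (ℤ × ℤ)} (hA : IsMinimal A) {x₀ y₀ : ℤ}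
    (hl : ∀ x ≤ x₀, (x, y₀) ∉ A) (hu : ∀ y ≤ y₀, (x₀, y) ∉ A) {a b : ℤ} (hab : (a, b) ∈ A)
    (ha : a ≤ x₀) (hb : b ≤ y₀) {c d : ℤ} (hcd : (c, d) ∈ A) : c ≤ x₀ ∧ d ≤ y₀ := by
  have h := (hA.image reflection).subset_lowerRight (x₀ := -x₀) (y₀ := y₀) (a := -a) (b := b)
    (c := -c) (d := d) (fun x hx => by rw [mem_reflection_image]; exact hl _ (by omega))
    (fun y hy => by rw [mem_reflection_image, neg_neg]; exact hu _ hy)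
    (by rwa [mem_reflection_image, neg_neg]) (by omega) hb
    (by rwa [mem_reflection_image, neg_neg])
  exact ⟨by omega, h.2⟩

/-! ### Corners and the four sides -/

/-- The points `nw`, `ne`, `sw`, `se` of `A` maximize `y - x`, maximize `y + x`, minimize `y + x`
and minimize `y - x` on `A`, respectively. -/
structure Corners (A : Set (ℤ × ℤ)) (nw ne sw se : ℤ × ℤ) : Prop where
  nw_mem : nw ∈ A
  ne_mem : ne ∈ A
  sw_mem : sw ∈ A
  se_mem : se ∈ A
  le_nw : ∀ {x y}, (x, y) ∈ A → y - x ≤ nw.2 - nw.1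
  le_ne : ∀ {x y}, (x, y) ∈ A → y + x ≤ ne.2 + ne.1
  sw_le : ∀ {x y}, (x, y) ∈ A → sw.2 + sw.1 ≤ y + x
  se_le : ∀ {x y}, (x, y) ∈ A → se.2 - se.1 ≤ y - x

theorem exists_corners {A : Set (ℤ × ℤ)} (hA : A.Finite) (hne : A.Nonempty) :
    ∃ nw ne sw se, Corners A nw ne sw se := by
  obtain ⟨p, hp, hpm⟩ := Set.exists_min_image A (fun q => q.2 - q.1) hA hne
  obtain ⟨q, hq, hqm⟩ := Set.exists_max_image A (fun q => q.2 - q.1) hA hne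
  obtain ⟨r, hr, hrm⟩ := Set.exists_min_image A (fun q => q.2 + q.1) hA hne
  obtain ⟨s, hs, hsm⟩ := Set.exists_max_image A (fun q => q.2 + q.1) hA hne
  exact ⟨q, s, r, p, hq, hs, hr, hp, fun h => hqm _ h, fun h => hsm _ h, fun h => hrm _ h,
    fun h => hpm _ h⟩

variable {A : Set (ℤ × ℤ)} {nw ne sw se : ℤ × ℤ}

theorem Corners.enc_eq (h : Corners A nw ne sw se) :
    enc A = box (se.2 - se.1) (nw.2 - nw.1) (sw.2 + sw.1) (ne.2 + ne.1) := by
  have hsub : A ⊆ box (se.2 - se.1) (nw.2 - nw.1) (sw.2 + sw.1) (ne.2 + ne.1) :=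
    fun v hv => ⟨⟨h.se_le hv, h.le_nw hv⟩, ⟨h.sw_le hv, h.le_ne hv⟩⟩
  apply Set.Subset.antisymm
  · exact Set.sInter_subset_of_mem ⟨⟨⟨_, hsub h.nw_mem⟩, _, _, _, _, rfl⟩, hsub⟩
  · rintro v ⟨⟨h1, h2⟩, h3, h4⟩ S ⟨⟨-, a, b, c, d, rfl⟩, hAS⟩
    exact ⟨⟨(hAS h.se_mem).1.1.trans h1, h2.trans (hAS h.nw_mem).1.2⟩,
      ⟨(hAS h.sw_mem).2.1.trans h3, h4.trans (hAS h.ne_mem).2.2⟩⟩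

theorem Corners.reflection (h : Corners A nw ne sw se) :
    Corners (reflection '' A) (-ne.1, ne.2) (-nw.1, nw.2) (-se.1, se.2) (-sw.1, sw.2) where
  nw_mem := mem_reflection_image.2 (by simpa using h.ne_mem)
  ne_mem := mem_reflection_image.2 (by simpa using h.nw_mem)
  sw_mem := mem_reflection_image.2 (by simpa using h.se_mem)
  se_mem := mem_reflection_image.2 (by simpa using h.sw_mem)
  le_nw hp := by
    have := h.le_ne (mem_reflection_image.1 hp)
    simp only
    omega
  le_ne hp := by
    have := h.le_nw (mem_reflection_image.1 hp)
    simp only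
    omega
  sw_le hp := by
    have := h.se_le (mem_reflection_image.1 hp)
    simp only
    omega
  se_le hp := by
    have := h.sw_le (mem_reflection_image.1 hp)
    simp only
    omega

theorem Corners.transposition (h : Corners A nw ne sw se) :
    Corners (transposition '' A) se.swap ne.swap sw.swap nw.swap where
  nw_mem := mem_transposition_image.2 h.se_mem
  ne_mem := mem_transposition_image.2 h.ne_mem
  sw_mem := mem_transposition_image.2 h.sw_mem
  se_mem := mem_transposition_image.2 h.nw_mem
  le_nw hp := by
    have := h.se_le (mem_transposition_image.1 hp)
    simp only [Prod.fst_swap, Prod.snd_swap]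
    omega
  le_ne hp := by
    have := h.le_ne (mem_transposition_image.1 hp)
    simp only [Prod.fst_swap, Prod.snd_swap]
    omega
  sw_le hp := by
    have := h.sw_le (mem_transposition_image.1 hp)
    simp only [Prod.fst_swap, Prod.snd_swap]
    omega
  se_le hp := by
    have := h.le_nw (mem_transposition_image.1 hp)
    simp only [Prod.fst_swap, Prod.snd_swap]
    omega

/-- The points just left of the leftmost point of `A` in a row between the corners. -/
def leftSide (A : Set (ℤ × ℤ)) (nw sw : ℤ × ℤ) : Set (ℤ × ℤ) :=
  {w | (sw.2 ≤ w.2 ∧ w.2 ≤ nw.2) ∧ (∀ x ≤ w.1, (x, w.2) ∉ A) ∧ (w.1 + 1, w.2) ∈ A}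

/-- The points just right of the rightmost point of `A` in a row between the corners. -/
def rightSide (A : Set (ℤ × ℤ)) (ne se : ℤ × ℤ) : Set (ℤ × ℤ) :=
  {w | (se.2 ≤ w.2 ∧ w.2 ≤ ne.2) ∧ (∀ x, w.1 ≤ x → (x, w.2) ∉ A) ∧ (w.1 - 1, w.2) ∈ A}

/-- The points just above the topmost point of `A` in a column between the corners. -/
def topSide (A : Set (ℤ × ℤ)) (nw ne : ℤ × ℤ) : Set (ℤ × ℤ) :=
  {w | (nw.1 ≤ w.1 ∧ w.1 ≤ ne.1) ∧ (∀ y, w.2 ≤ y → (w.1, y) ∉ A) ∧ (w.1, w.2 - 1) ∈ A}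

/-- The points just below the lowest point of `A` in a column between the corners. -/
def bottomSide (A : Set (ℤ × ℤ)) (sw se : ℤ × ℤ) : Set (ℤ × ℤ) :=
  {w | (sw.1 ≤ w.1 ∧ w.1 ≤ se.1) ∧ (∀ y ≤ w.2, (w.1, y) ∉ A) ∧ (w.1, w.2 + 1) ∈ A}

theorem mem_rightSide_iff {x y : ℤ} : (x, y) ∈ rightSide A ne se ↔
    (-x, y) ∈ leftSide (reflection '' A) (-ne.1, ne.2) (-se.1, se.2) := by
  simp only [rightSide, leftSide, Set.mem_ofPred_eq, mem_reflection_image]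
  refine and_congr_right fun _ => and_congr ⟨fun h a ha => h _ (by omega), fun h a ha => ?_⟩ ?_
  · simpa using h (-a) (by omega)
  · rw [show -(-x + 1) = x - 1 by ring]

theorem mem_bottomSide_iff {x y : ℤ} : (x, y) ∈ bottomSide A sw se ↔
    (y, x) ∈ leftSide (transposition '' A) se.swap sw.swap := by
  simp only [bottomSide, leftSide, Set.mem_ofPred_eq, mem_transposition_image,
    Prod.snd_swap]

theorem mem_topSide_iff {x y : ℤ} : (x, y) ∈ topSide A nw ne ↔
    (y, x) ∈ rightSide (transposition '' A) ne.swap nw.swap := by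
  simp only [topSide, rightSide, Set.mem_ofPred_eq, mem_transposition_image,
    Prod.snd_swap]

theorem exists_mem_leftSide (hA : IsMinimal A) (hc : Corners A nw ne sw se) {y : ℤ}
    (h₁ : sw.2 ≤ y) (h₂ : y ≤ nw.2) : ∃ x, (x, y) ∈ leftSide A nw sw := by
  have hrow : ∃ x, (x, y) ∈ A := by
    by_contra! hrow
    obtain ⟨X, hX⟩ := (hA.1.image Prod.fst).bddAbove
    have hX' : ∀ {a b}, (a, b) ∈ A → a ≤ X := fun h => hX ⟨_, h, rfl⟩
    -- The column `X + 1` is right of all of `A`, so an empty row turns the quadrant into a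
    -- half-plane, and `nw` drags `sw` into it.
    have h := hA.subset_upperLeft (x₀ := X + 1) (y₀ := y) (fun x _ => hrow x)
      (fun b _ hb => by have := hX' hb; omega) hc.nw_mem
      (by have := hX' hc.nw_mem; omega) h₂ hc.sw_mem
    obtain rfl : y = sw.2 := by omega
    exact hrow _ hc.sw_mem
  obtain ⟨⟨a, b⟩, ⟨hab, rfl⟩, hmin⟩ := Set.exists_min_image (A ∩ {p | p.2 = y}) Prod.fst
    (hA.1.inter_of_left _) (hrow.imp' (fun x => (x, y)) fun x hx => ⟨hx, rfl⟩)
  refine ⟨a - 1, ⟨h₁, h₂⟩, fun x hx h => ?_, by simpa using hab⟩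
  have := hmin _ ⟨h, rfl⟩
  simp only at *
  omega

theorem exists_mem_rightSide (hA : IsMinimal A) (hc : Corners A nw ne sw se) {y : ℤ}
    (h₁ : se.2 ≤ y) (h₂ : y ≤ ne.2) : ∃ x, (x, y) ∈ rightSide A ne se := by
  obtain ⟨x, hx⟩ := exists_mem_leftSide (hA.image reflection) hc.reflection h₁ h₂
  exact ⟨-x, mem_rightSide_iff.2 (by simpa using hx)⟩

theorem exists_mem_bottomSide (hA : IsMinimal A) (hc : Corners A nw ne sw se) {x : ℤ}
    (h₁ : sw.1 ≤ x) (h₂ : x ≤ se.1) : ∃ y, (x, y) ∈ bottomSide A sw se := by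
  obtain ⟨y, hy⟩ := exists_mem_leftSide (hA.image transposition) hc.transposition h₁ h₂
  exact ⟨y, mem_bottomSide_iff.2 hy⟩

theorem exists_mem_topSide (hA : IsMinimal A) (hc : Corners A nw ne sw se) {x : ℤ}
    (h₁ : nw.1 ≤ x) (h₂ : x ≤ ne.1) : ∃ y, (x, y) ∈ topSide A nw ne := by
  obtain ⟨y, hy⟩ := exists_mem_rightSide (hA.image transposition) hc.transposition h₁ h₂
  exact ⟨y, mem_topSide_iff.2 hy⟩

theorem sub_add_one_le_ncard {S : Set (ℤ × ℤ)} (hS : S.Finite) (f : ℤ × ℤ → ℤ) {lo hi : ℤ}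
    (h : ∀ k, lo ≤ k → k ≤ hi → ∃ p ∈ S, f p = k) : hi - lo + 1 ≤ S.ncard := by
  have h1 : Set.Icc lo hi ⊆ f '' S := fun k hk => h k hk.1 hk.2
  have h2 := (Set.ncard_le_ncard h1 (hS.image f)).trans (Set.ncard_image_le hS)
  rw [← Finset.coe_Icc, Set.ncard_coe_finset, Int.card_Icc] at h2
  omega

theorem leftSide_subset : leftSide A nw sw ⊆ boundary lattice A :=
  fun _ h => mem_boundary.2 ⟨h.2.1 _ le_rfl, .inl h.2.2⟩

theorem rightSide_subset : rightSide A ne se ⊆ boundary lattice A :=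
  fun _ h => mem_boundary.2 ⟨h.2.1 _ le_rfl, .inr (.inl h.2.2)⟩

theorem topSide_subset : topSide A nw ne ⊆ boundary lattice A :=
  fun _ h => mem_boundary.2 ⟨h.2.1 _ le_rfl, .inr (.inr (.inr h.2.2))⟩

theorem bottomSide_subset : bottomSide A sw se ⊆ boundary lattice A :=
  fun _ h => mem_boundary.2 ⟨h.2.1 _ le_rfl, .inr (.inr (.inl h.2.2))⟩

theorem disjoint_leftSide_rightSide : Disjoint (leftSide A nw sw) (rightSide A ne se) := by
  rw [Set.disjoint_left]
  rintro ⟨x, y⟩ ⟨-, h, -⟩ ⟨-, -, h'⟩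
  exact h _ (by simp) h'

theorem disjoint_bottomSide_topSide : Disjoint (bottomSide A sw se) (topSide A nw ne) := by
  rw [Set.disjoint_left]
  rintro ⟨x, y⟩ ⟨-, h, -⟩ ⟨-, -, h'⟩
  exact h _ (by simp) h'

/-- A common point would emit two perpendicular free rays with a corner of `A` between them; the
quadrant lemma then excludes the point of `A` on its other side. -/
theorem disjoint_leftRight_bottomTop (hA : IsMinimal A) (hc : Corners A nw ne sw se) :
    Disjoint (leftSide A nw sw ∪ rightSide A ne se) (bottomSide A sw se ∪ topSide A nw ne) := by
  rw [Set.disjoint_left]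
  rintro ⟨x, y⟩ (⟨h1, h2, h3⟩ | ⟨h1, h2, h3⟩) (⟨h4, h5, -⟩ | ⟨h4, h5, -⟩)
  · have := hA.subset_lowerLeft h2 h5 hc.sw_mem h4.1 h1.1 h3
    omega
  · have := hA.subset_upperLeft h2 h5 hc.nw_mem h4.1 h1.2 h3
    omega
  · have := hA.subset_lowerRight h2 h5 hc.se_mem h4.2 h1.1 h3
    omega
  · have := hA.subset_upperRight h2 h5 hc.ne_mem h4.2 h1.2 h3
    omega

/-- The four side lengths regroup into the ranges of `y - x` and `y + x`. A side whose range of rows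
or columns is empty contributes a nonpositive length, which is harmless. -/
theorem le_ncard_sides (hA : IsMinimal A) (hc : Corners A nw ne sw se) :
    (nw.2 - nw.1) - (se.2 - se.1) + ((ne.2 + ne.1) - (sw.2 + sw.1)) + 4 ≤
      (((leftSide A nw sw ∪ rightSide A ne se) ∪
        (bottomSide A sw se ∪ topSide A nw ne)).ncard : ℤ) := by
  have hfin := finite_boundary hA.1
  have fl := hfin.subset (leftSide_subset (A := A) (nw := nw) (sw := sw))
  have fr := hfin.subset (rightSide_subset (A := A) (ne := ne) (se := se))
  have fb := hfin.subset (bottomSide_subset (A := A) (sw := sw) (se := se))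
  have ft := hfin.subset (topSide_subset (A := A) (nw := nw) (ne := ne))
  rw [Set.ncard_union_eq (disjoint_leftRight_bottomTop hA hc) (fl.union fr) (fb.union ft),
    Set.ncard_union_eq disjoint_leftSide_rightSide fl fr,
    Set.ncard_union_eq disjoint_bottomSide_topSide fb ft]
  have hl := sub_add_one_le_ncard fl Prod.snd (lo := sw.2) (hi := nw.2) fun y h h' =>
    (exists_mem_leftSide hA hc h h').imp' (fun x => (x, y)) fun _ hx => ⟨hx, rfl⟩
  have hr := sub_add_one_le_ncard fr Prod.snd (lo := se.2) (hi := ne.2) fun y h h' =>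
    (exists_mem_rightSide hA hc h h').imp' (fun x => (x, y)) fun _ hx => ⟨hx, rfl⟩
  have hb := sub_add_one_le_ncard fb Prod.fst (lo := sw.1) (hi := se.1) fun x h h' =>
    (exists_mem_bottomSide hA hc h h').imp' (fun y => (x, y)) fun _ hx => ⟨hx, rfl⟩
  have ht := sub_add_one_le_ncard ft Prod.fst (lo := nw.1) (hi := ne.1) fun x h h' =>
    (exists_mem_topSide hA hc h h').imp' (fun y => (x, y)) fun _ hx => ⟨hx, rfl⟩
  push_cast
  omega

theorem sides_subset_boundary : (leftSide A nw sw ∪ rightSide A ne se) ∪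
    (bottomSide A sw se ∪ topSide A nw ne) ⊆ boundary lattice A :=
  Set.union_subset (Set.union_subset leftSide_subset rightSide_subset)
    (Set.union_subset bottomSide_subset topSide_subset)

/-! ### The boundary of a box, and equality for minimal sets -/

/-- The boundary lies on the perimeter of the rectangle enlarged by one in the coordinates `(y - x,
y + x)`. These coordinates have equal parity at lattice points, so only every second perimeter
position is taken. -/
theorem ncard_boundary_box_le {a b c d : ℤ} (hab : a ≤ b) (hcd : c ≤ d) :
    ((boundary lattice (box a b c d)).ncard : ℤ) ≤ (b - a) + (d - c) + 4 := by
  -- half the position of a boundary point along the enlarged rectangle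
  let f : ℤ × ℤ → ℤ := fun p =>
    (if p.2 + p.1 = c - 1 then p.2 - p.1 - (a - 1)
    else if p.2 - p.1 = b + 1 then (b - a + 2) + (p.2 + p.1 - (c - 1))
    else if p.2 + p.1 = d + 1 then (b - a + 2) + (d - c + 2) + (b + 1 - (p.2 - p.1))
    else 2 * (b - a + 2) + (d - c + 2) + (d + 1 - (p.2 + p.1))) / 2
  have hmem : ∀ x y, (x, y) ∈ boundary lattice (box a b c d) →
      (a - 1 ≤ y - x ∧ y - x ≤ b + 1 ∧ c - 1 ≤ y + x ∧ y + x ≤ d + 1) ∧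
        (y - x = a - 1 ∨ y - x = b + 1 ∨ y + x = c - 1 ∨ y + x = d + 1) := by
    intro x y h
    rw [mem_boundary] at h
    simp only [box, Set.mem_ofPred_eq] at h
    omega
  have hinj : Set.InjOn f (boundary lattice (box a b c d)) := by
    rintro ⟨x, y⟩ h ⟨x', y'⟩ h' heq
    have h1 := hmem _ _ h
    have h2 := hmem _ _ h'
    simp only [f] at heq
    rw [Prod.mk.injEq]
    split_ifs at heq <;> omega
  have hmaps : Set.MapsTo f (boundary lattice (box a b c d))
      (Set.Ico 0 ((b - a) + (d - c) + 4)) := by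
    rintro ⟨x, y⟩ h
    have h1 := hmem _ _ h
    simp only [f, Set.mem_Ico]
    split_ifs <;> omega
  have h := Set.ncard_le_ncard_of_injOn f hmaps hinj (Set.finite_Ico _ _)
  rw [← Finset.coe_Ico, Set.ncard_coe_finset, Int.card_Ico] at h
  omega

theorem Corners.ncard_boundary_enc_le (hc : Corners A nw ne sw se) :
    ((boundary lattice (enc A)).ncard : ℤ) ≤
      (nw.2 - nw.1) - (se.2 - se.1) + ((ne.2 + ne.1) - (sw.2 + sw.1)) + 4 := by
  rw [hc.enc_eq]
  exact ncard_boundary_box_le (hc.se_le hc.nw_mem) (hc.sw_le hc.ne_mem)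

theorem finite_box (a b c d : ℤ) : (box a b c d).Finite := by
  refine ((Set.finite_Icc a b).prod (Set.finite_Icc c d)).of_injOn
    (f := fun p => (p.2 - p.1, p.2 + p.1)) (fun p hp => hp) ?_
  rintro ⟨x, y⟩ - ⟨x', y'⟩ - h
  simp only [Prod.mk.injEq] at h ⊢
  omega

theorem ncard_box_le (a b c d : ℤ) :
    (box a b c d).ncard ≤ (b + 1 - a).toNat * (d + 1 - c).toNat := by
  have h := Set.ncard_le_ncard_of_injOn (s := box a b c d) (t := Set.Icc a b ×ˢ Set.Icc c d)
    (fun p => (p.2 - p.1, p.2 + p.1)) (fun p hp => hp) (by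
      rintro ⟨x, y⟩ - ⟨x', y'⟩ - h
      simp only [Prod.mk.injEq] at h ⊢
      omega) ((Set.finite_Icc a b).prod (Set.finite_Icc c d))
  rwa [Set.ncard_prod, ← Finset.coe_Icc, ← Finset.coe_Icc, Set.ncard_coe_finset,
    Set.ncard_coe_finset, Int.card_Icc, Int.card_Icc] at h

theorem finite_enc (hfin : A.Finite) (hne : A.Nonempty) : (enc A).Finite := by
  obtain ⟨nw, ne, sw, se, hc⟩ := exists_corners hfin hne
  rw [hc.enc_eq]
  exact finite_box _ _ _ _

theorem subset_enc : A ⊆ enc A := fun _ hx _ hS => hS.2 hx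

theorem IsMinimal.ncard_boundary_le_enc (hA : IsMinimal A) (hne : A.Nonempty) :
    (boundary lattice A).ncard ≤ (boundary lattice (enc A)).ncard :=
  hA.ncard_boundary_le (finite_enc hA.1 hne)
    (Set.ncard_le_ncard subset_enc (finite_enc hA.1 hne))

/-- The sides are at least as numerous as the upper bound for `∂(enc A)`, which by monotonicity also
bounds `∂A`; nothing is left over. -/
theorem IsMinimal.boundary_eq_sides (hA : IsMinimal A) (hc : Corners A nw ne sw se) :
    (leftSide A nw sw ∪ rightSide A ne se) ∪ (bottomSide A sw se ∪ topSide A nw ne) =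
      boundary lattice A := by
  refine Set.eq_of_subset_of_ncard_le sides_subset_boundary ?_ (finite_boundary hA.1)
  have h1 := le_ncard_sides hA hc
  have h2 := hA.ncard_boundary_le_enc ⟨_, hc.nw_mem⟩
  have h3 := hc.ncard_boundary_enc_le
  omega

theorem IsMinimal.ncard_boundary_eq (hA : IsMinimal A) (hc : Corners A nw ne sw se) :
    ((boundary lattice A).ncard : ℤ) =
      (nw.2 - nw.1) - (se.2 - se.1) + ((ne.2 + ne.1) - (sw.2 + sw.1)) + 4 := by
  have h1 := le_ncard_sides hA hc
  have h2 := hA.ncard_boundary_le_enc ⟨_, hc.nw_mem⟩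
  have h3 := hc.ncard_boundary_enc_le
  rw [hA.boundary_eq_sides hc] at h1
  omega

theorem IsMinimal.ncard_boundary_eq_enc (hA : IsMinimal A) (hne : A.Nonempty) :
    (boundary lattice A).ncard = (boundary lattice (enc A)).ncard := by
  obtain ⟨nw, ne, sw, se, hc⟩ := exists_corners hA.1 hne
  have h1 := hA.ncard_boundary_eq hc
  have h2 := hA.ncard_boundary_le_enc hne
  have h3 := hc.ncard_boundary_enc_le
  omega

/-! ### The maximum defining the excess exists -/

theorem Corners.lt_or_lt (hc : Corners A nw ne sw se) (h : 2 ≤ A.ncard) :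
    se.2 - se.1 < nw.2 - nw.1 ∨ sw.2 + sw.1 < ne.2 + ne.1 := by
  by_contra hcon
  have hle := (Set.ncard_le_ncard (subset_enc (A := A)) (hc.enc_eq ▸ finite_box _ _ _ _))
  rw [hc.enc_eq] at hle
  have h1 := ncard_box_le (se.2 - se.1) (nw.2 - nw.1) (sw.2 + sw.1) (ne.2 + ne.1)
  have h2 : (nw.2 - nw.1 + 1 - (se.2 - se.1)).toNat ≤ 1 := by omega
  have h3 : (ne.2 + ne.1 + 1 - (sw.2 + sw.1)).toNat ≤ 1 := by omega
  have := Nat.mul_le_mul h2 h3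
  omega

/-- Widening the enclosing box by one line raises the boundary bound by one and adds a lattice
point, provided the perpendicular range contains both parities. With two points in `A`, one of the
two directions qualifies. -/
theorem IsMinimal.ncard_boundary_le_succ {B : Set (ℤ × ℤ)} (hA : IsMinimal A) (hB : IsMinimal B)
    (h : 2 ≤ A.ncard) (hAB : B.ncard = A.ncard + 1) :
    (boundary lattice B).ncard ≤ (boundary lattice A).ncard + 1 := by
  have hne : A.Nonempty := (Set.ncard_pos hA.1).1 (by omega)
  obtain ⟨nw, ne, sw, se, hc⟩ := exists_corners hA.1 hne
  have heq := hA.ncard_boundary_eq hc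
  have h1 := hc.se_le hc.nw_mem
  have h2 := hc.sw_le hc.ne_mem
  have main : ∀ a b c d : ℤ, A ⊆ box a b c d → (∃ p ∈ box a b c d, p ∉ A) → a ≤ b → c ≤ d →
      (b - a) + (d - c) + 4 = ((boundary lattice A).ncard : ℤ) + 1 →
      (boundary lattice B).ncard ≤ (boundary lattice A).ncard + 1 := by
    intro a b c d hsub hp hab hcd hcard
    have hlt := Set.ncard_lt_ncard ((Set.ssubset_iff_of_subset hsub).2 hp) (finite_box a b c d)
    have h3 := hB.ncard_boundary_le (finite_box a b c d) (by omega)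
    have h4 := ncard_boundary_box_le hab hcd
    omega
  have hsub : ∀ {x y}, (x, y) ∈ A → _ := fun hp =>
    And.intro (And.intro (hc.se_le hp) (hc.le_nw hp)) (And.intro (hc.sw_le hp) (hc.le_ne hp))
  rcases le_or_gt (ne.2 + ne.1) (sw.2 + sw.1) with hlt | hlt
  · have hlt' := hc.lt_or_lt h
    refine main (se.2 - se.1) (nw.2 - nw.1) (sw.2 + sw.1) (ne.2 + ne.1 + 1) ?_ ?_ (by omega)
      (by omega) (by omega)
    · rintro ⟨x, y⟩ hp
      have := hsub hp
      simp only [box, Set.mem_ofPred_eq]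
      omega
    -- On the new line, rounding up makes `y - x` equal to its minimum or the minimum plus one,
    -- whichever parity fits.
    · refine ⟨((ne.2 + ne.1 + 1) - (se.2 - se.1 + (ne.2 + ne.1 + 1) + 1) / 2,
        (se.2 - se.1 + (ne.2 + ne.1 + 1) + 1) / 2), ?_, fun hp => ?_⟩
      · simp only [box, Set.mem_ofPred_eq]
        omega
      · have := hsub hp
        omega
  · refine main (se.2 - se.1) (nw.2 - nw.1 + 1) (sw.2 + sw.1) (ne.2 + ne.1) ?_ ?_ (by omega)
      (by omega) (by omega)
    · rintro ⟨x, y⟩ hp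
      have := hsub hp
      simp only [box, Set.mem_ofPred_eq]
      omega
    · refine ⟨((nw.2 - nw.1 + 1 + (sw.2 + sw.1) + 1) / 2 - (nw.2 - nw.1 + 1),
        (nw.2 - nw.1 + 1 + (sw.2 + sw.1) + 1) / 2), ?_, fun hp => ?_⟩
      · simp only [box, Set.mem_ofPred_eq]
        omega
      · have := hsub hp
        omega

theorem exists_isMinimal_lt_ncard_boundary (s : ℕ) :
    ∃ n, 2 ≤ n ∧ ∀ B, IsMinimal B → B.ncard = n → s < (boundary lattice B).ncard := by
  -- A boundary of at most `s` points confines `B` to a box with at most `s + 1` values in each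
  -- diagonal coordinate.
  refine ⟨(s + 1) * (s + 1) + 2, by omega, fun B hB hn => ?_⟩
  have hne : B.Nonempty := (Set.ncard_pos hB.1).1 (by omega)
  obtain ⟨nw, ne, sw, se, hc⟩ := exists_corners hB.1 hne
  have heq := hB.ncard_boundary_eq hc
  have h1 := hc.se_le hc.nw_mem
  have h2 := hc.sw_le hc.ne_mem
  by_contra hle
  have hle' := (Set.ncard_le_ncard (subset_enc (A := B)) (hc.enc_eq ▸ finite_box _ _ _ _))
  rw [hc.enc_eq] at hle'
  have h3 := ncard_box_le (se.2 - se.1) (nw.2 - nw.1) (sw.2 + sw.1) (ne.2 + ne.1)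
  have h4 : (nw.2 - nw.1 + 1 - (se.2 - se.1)).toNat ≤ s + 1 := by omega
  have h5 : (ne.2 + ne.1 + 1 - (sw.2 + sw.1)).toNat ≤ s + 1 := by omega
  have := Nat.mul_le_mul h4 h5
  omega

theorem six_le_ncard_boundary {S : Set (ℤ × ℤ)} (hS : S.Finite) (h : 2 ≤ S.ncard) :
    6 ≤ (boundary lattice S).ncard := by
  obtain ⟨B, hB, hn⟩ := exists_isMinimal 2
  refine le_trans ?_ (hB.ncard_boundary_le hS (by omega))
  obtain ⟨nw, ne, sw, se, hc⟩ := exists_corners hB.1 ((Set.ncard_pos hB.1).1 (by omega))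
  have h1 := hc.lt_or_lt hn.ge
  have h2 := hB.ncard_boundary_eq hc
  have h3 := hc.se_le hc.nw_mem
  have h4 := hc.sw_le hc.ne_mem
  by_contra hcon
  -- a range of length zero in one direction forces equal parities in the other
  have h5 := hc.le_nw hc.ne_mem
  have h6 := hc.le_nw hc.sw_mem
  have h7 := hc.se_le hc.ne_mem
  have h8 := hc.se_le hc.sw_mem
  have h9 := hc.le_ne hc.nw_mem
  have h10 := hc.le_ne hc.se_mem
  have h11 := hc.sw_le hc.nw_mem
  have h12 := hc.sw_le hc.se_mem
  omega

/-- A discrete intermediate value argument: from two points on, minimal boundary sizes start at most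
at 6, grow by at most one and are unbounded. One-point sets are separate because their boundary size
4 is followed by a jump to 6. -/
theorem exists_isMinimal_ncard_boundary_eq {S : Set (ℤ × ℤ)} (hS : S.Finite) (hne : S.Nonempty) :
    ∃ B, IsMinimal B ∧ (boundary lattice S).ncard = (boundary lattice B).ncard := by
  have hpos := (Set.ncard_pos hS).2 hne
  rcases lt_or_ge S.ncard 2 with h | h
  · obtain ⟨B, hB, hn⟩ := exists_isMinimal 1
    obtain ⟨p, rfl⟩ := Set.ncard_eq_one.1 (show S.ncard = 1 by omega)
    obtain ⟨q, rfl⟩ := Set.ncard_eq_one.1 hn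
    refine ⟨{q}, hB, ?_⟩
    rw [← ncard_boundary_image (translation (p - q)) {q}, Set.image_singleton]
    congr
    exact (add_sub_cancel q p).symm
  · have h6 := six_le_ncard_boundary hS h
    by_contra! hcon
    have main : ∀ n, 2 ≤ n → ∃ B, IsMinimal B ∧ B.ncard = n ∧
        (boundary lattice B).ncard < (boundary lattice S).ncard := by
      intro n hn
      induction n, hn using Nat.le_induction with
      | base =>
        obtain ⟨B, hB, hn⟩ := exists_isMinimal 2
        refine ⟨B, hB, hn, lt_of_le_of_ne (le_trans ?_ h6) (hcon B hB).symm⟩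
        have h1 : 2 ≤ (box 0 1 0 1).ncard := by
          rw [← Set.ncard_pair (show ((0, 0) : ℤ × ℤ) ≠ (0, 1) by simp)]
          refine Set.ncard_le_ncard ?_ (finite_box _ _ _ _)
          rintro _ (rfl | rfl) <;> simp [box]
        have h2 := hB.ncard_boundary_le (finite_box 0 1 0 1) (by omega)
        have h3 := ncard_boundary_box_le (show (0 : ℤ) ≤ 1 by omega) (show (0 : ℤ) ≤ 1 by omega)
        omega
      | succ n hn ih =>
        obtain ⟨B, hB, hBn, hlt⟩ := ih
        obtain ⟨C, hC, hCn⟩ := exists_isMinimal (n + 1)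
        have := hB.ncard_boundary_le_succ hC (by omega) (by omega)
        exact ⟨C, hC, hCn, lt_of_le_of_ne (by omega) (hcon C hC).symm⟩
    obtain ⟨n, hn, hlt⟩ := exists_isMinimal_lt_ncard_boundary (boundary lattice S).ncard
    obtain ⟨B, hB, hBn, h'⟩ := main n hn
    exact absurd (hlt B hB hBn) (by omega)

theorem isGreatest_excess {S : Set (ℤ × ℤ)} (hS : S.Finite) (hne : S.Nonempty) :
    IsGreatest (excessSet S) (excess S) := by
  obtain ⟨B, hB, h⟩ := exists_isMinimal_ncard_boundary_eq hS hne
  have hbdd : BddAbove (excessSet S) := by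
    refine ⟨S.ncard, ?_⟩
    rintro _ ⟨C, -, -, rfl⟩
    omega
  exact ⟨Int.csSup_mem ⟨_, B, hB, h, rfl⟩ hbdd, fun k hk => le_csSup hbdd hk⟩

/-- Compare with a minimal `B` attaining the excess of `enc A`: the bound on the number of missing
points says exactly `|B| ≤ |A|`. -/
theorem isMinimal_of_ncard_boundary_le (hfin : A.Finite) (hne : A.Nonempty)
    (h : (boundary lattice A).ncard ≤ (boundary lattice (enc A)).ncard)
    (hN : ((enc A \ A).ncard : ℤ) ≤ excess (enc A)) : IsMinimal A := by
  have hefin := finite_enc hfin hne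
  obtain ⟨B, hB, hb, hk⟩ := (isGreatest_excess hefin (hne.mono subset_enc)).1
  have := Set.ncard_sdiff_add_ncard_of_subset (subset_enc (A := A)) hefin
  exact hB.of_ncard_le hfin (by omega) (by omega)

theorem IsMinimal.ncard_enc_diff_le (hA : IsMinimal A) (hne : A.Nonempty) :
    ((enc A \ A).ncard : ℤ) ≤ excess (enc A) := by
  have hefin := finite_enc hA.1 hne
  have := Set.ncard_sdiff_add_ncard_of_subset (subset_enc (A := A)) hefin
  exact (isGreatest_excess hefin (hne.mono subset_enc)).2
    ⟨A, hA, (hA.ncard_boundary_eq_enc hne).symm, by omega⟩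

/-! ### Automorphisms of the lattice and cones -/

theorem adj_iff_sub (p q : ℤ × ℤ) : lattice.Adj p q ↔
    q - p = (1, 0) ∨ q - p = (-1, 0) ∨ q - p = (0, 1) ∨ q - p = (0, -1) := by
  obtain ⟨a, b⟩ := p
  obtain ⟨c, d⟩ := q
  simp only [adj_iff, Prod.mk.injEq, Prod.mk_sub_mk]
  omega

/-- An automorphism maps three consecutive points of a row to three collinear points. -/
theorem iso_apply_sub_left (φ : lattice ≃g lattice) (x y : ℤ) :
    φ (x + 1, y) - φ (x, y) = φ (x, y) - φ (x - 1, y) := by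
  by_contra hne
  have h1 : lattice.Adj (φ (x, y)) (φ (x + 1, y)) := φ.map_adj_iff.2 ((adj_iff _ _).2 (by simp))
  have h2 : lattice.Adj (φ (x, y)) (φ (x - 1, y)) := φ.map_adj_iff.2 ((adj_iff _ _).2 (by simp))
  -- The fourth vertex of the parallelogram is a common neighbour of the two outer images, but `(x -
  -- 1, y)` and `(x + 1, y)` have only `(x, y)` in common.
  obtain ⟨w, hw⟩ := φ.surjective (φ (x + 1, y) + φ (x - 1, y) - φ (x, y))
  have h3 : lattice.Adj (φ (x + 1, y)) (φ w) := by
    rw [adj_iff_sub] at h2 ⊢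
    rwa [hw, show ∀ p q r : ℤ × ℤ, p + q - r - p = q - r from fun _ _ _ => by abel]
  have h4 : lattice.Adj (φ (x - 1, y)) (φ w) := by
    rw [adj_iff_sub] at h1 ⊢
    rwa [hw, show ∀ p q r : ℤ × ℤ, p + q - r - q = p - r from fun _ _ _ => by abel]
  rw [φ.map_adj_iff, adj_iff] at h3 h4
  have : w = (x, y) := by
    obtain ⟨w₁, w₂⟩ := w
    simp only [Prod.mk.injEq] at h3 h4 ⊢
    omega
  rw [this] at hw
  exact hne (sub_eq_sub_iff_add_eq_add.2 (eq_add_of_sub_eq hw.symm))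

theorem iso_apply_sub_below (φ : lattice ≃g lattice) (x y : ℤ) :
    φ (x, y + 1) - φ (x, y) = φ (x, y) - φ (x, y - 1) :=
  iso_apply_sub_left (transposition.trans φ) y x

/-- An automorphism maps unit squares to unit squares. -/
theorem exists_iso_apply (φ : lattice ≃g lattice) (x y : ℤ) :
    ∃ a b : ℤ × ℤ, φ (x + 1, y) = φ (x, y) + a ∧ φ (x, y + 1) = φ (x, y) + b ∧
      φ (x + 1, y + 1) = φ (x, y) + a + b ∧
      (((a = (1, 0) ∨ a = (-1, 0)) ∧ (b = (0, 1) ∨ b = (0, -1))) ∨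
        ((a = (0, 1) ∨ a = (0, -1)) ∧ (b = (1, 0) ∨ b = (-1, 0)))) := by
  have h1 : lattice.Adj (φ (x, y)) (φ (x + 1, y)) := φ.map_adj_iff.2 ((adj_iff _ _).2 (by simp))
  have h2 : lattice.Adj (φ (x, y)) (φ (x, y + 1)) := φ.map_adj_iff.2 ((adj_iff _ _).2 (by simp))
  have h3 : lattice.Adj (φ (x + 1, y)) (φ (x + 1, y + 1)) :=
    φ.map_adj_iff.2 ((adj_iff _ _).2 (by simp))
  have h4 : lattice.Adj (φ (x, y + 1)) (φ (x + 1, y + 1)) :=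
    φ.map_adj_iff.2 ((adj_iff _ _).2 (by simp))
  have h5 := iso_apply_sub_left φ x y
  have n1 : φ (x + 1, y) ≠ φ (x, y + 1) := fun h => by simpa using φ.injective h
  have n2 : φ (x - 1, y) ≠ φ (x, y + 1) := fun h => by
    have := φ.injective h
    simp at this
  have n3 : φ (x + 1, y + 1) ≠ φ (x, y) := fun h => by simpa using φ.injective h
  refine ⟨φ (x + 1, y) - φ (x, y), φ (x, y + 1) - φ (x, y), by abel, by abel, ?_⟩
  simp only [adj_iff_sub] at h1 h2 h3 h4
  generalize φ (x, y) = p at *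
  generalize φ (x + 1, y) = q at *
  generalize φ (x - 1, y) = q' at *
  generalize φ (x, y + 1) = r at *
  generalize φ (x + 1, y + 1) = s at *
  obtain ⟨p₁, p₂⟩ := p
  obtain ⟨q₁, q₂⟩ := q
  obtain ⟨q'₁, q'₂⟩ := q'
  obtain ⟨r₁, r₂⟩ := r
  obtain ⟨s₁, s₂⟩ := s
  simp only [ne_eq, Prod.mk.injEq, Prod.mk_sub_mk, Prod.mk_add_mk] at *
  rcases h1 with h1 | h1 | h1 | h1 <;> rcases h2 with h2 | h2 | h2 | h2 <;> omega

theorem eq_add_zsmul_of_forall {f : ℤ → ℤ × ℤ} {a : ℤ × ℤ} (h : ∀ x, f (x + 1) = f x + a) (x : ℤ) :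
    f x = f 0 + x • a := by
  induction x using Int.induction_on with
  | zero => simp
  | succ n ih => rw [h, ih, add_smul, one_smul, add_assoc]
  | pred n ih =>
    have := h (-n - 1)
    rw [sub_add_cancel, ih] at this
    rw [sub_smul, one_smul, ← add_sub_assoc, this, add_sub_cancel_right]

/-- Unit squares make horizontal increments independent of the row, and collinearity makes
increments constant along each axis, so automorphisms are affine. -/
theorem exists_iso_eq (φ : lattice ≃g lattice) : ∃ t a b : ℤ × ℤ,
    (∀ x y, φ (x, y) = t + x • a + y • b) ∧
      (((a = (1, 0) ∨ a = (-1, 0)) ∧ (b = (0, 1) ∨ b = (0, -1))) ∨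
        ((a = (0, 1) ∨ a = (0, -1)) ∧ (b = (1, 0) ∨ b = (-1, 0)))) := by
  obtain ⟨a, b, ha, hb, -, hab⟩ := exists_iso_apply φ 0 0
  refine ⟨φ (0, 0), a, b, fun x y => ?_, hab⟩
  have dx : ∀ x y, φ (x + 1, y) - φ (x, y) = φ (x + 1, 0) - φ (x, 0) := fun x y => by
    have := eq_add_zsmul_of_forall (f := fun y => φ (x + 1, y) - φ (x, y)) (a := 0) (fun y => by
      obtain ⟨a, b, ha, hb, hc, -⟩ := exists_iso_apply φ x y
      simp only [ha, hb, hc]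
      abel) y
    simpa using this
  have dx0 : ∀ x, φ (x + 1, 0) - φ (x, 0) = a := fun x => by
    have := eq_add_zsmul_of_forall (f := fun x => φ (x + 1, 0) - φ (x, 0)) (a := 0) (fun x => by
      have := iso_apply_sub_left φ (x + 1) 0
      rw [add_sub_cancel_right] at this
      simpa using this) x
    simp only [smul_zero, add_zero, zero_add] at this
    rw [this, ← zero_add (1 : ℤ), ha, add_sub_cancel_left]
  have dy0 : ∀ y, φ (0, y + 1) - φ (0, y) = b := fun y => by
    have := eq_add_zsmul_of_forall (f := fun y => φ (0, y + 1) - φ (0, y)) (a := 0) (fun y => by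
      have := iso_apply_sub_below φ 0 (y + 1)
      rw [add_sub_cancel_right] at this
      simpa using this) y
    simp only [smul_zero, add_zero, zero_add] at this
    rw [this, ← zero_add (1 : ℤ), hb, add_sub_cancel_left]
  have h1 := eq_add_zsmul_of_forall (f := fun x => φ (x, y)) (a := a)
    (fun x => by rw [← dx0 x, ← dx x y]; abel) x
  have h2 := eq_add_zsmul_of_forall (f := fun y => φ (0, y)) (a := b)
    (fun y => by rw [← dy0 y]; abel) y
  rw [h1, h2]
  abel

/-- The upward cone at `z`. -/
def upCone (z : ℤ × ℤ) : Set (ℤ × ℤ) := {p | z.2 - z.1 ≤ p.2 - p.1 ∧ z.2 + z.1 ≤ p.2 + p.1}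

/-- The downward cone at `z`. -/
def downCone (z : ℤ × ℤ) : Set (ℤ × ℤ) := {p | p.2 - p.1 ≤ z.2 - z.1 ∧ p.2 + p.1 ≤ z.2 + z.1}

/-- The leftward cone at `z`. -/
def leftCone (z : ℤ × ℤ) : Set (ℤ × ℤ) := {p | z.2 - z.1 ≤ p.2 - p.1 ∧ p.2 + p.1 ≤ z.2 + z.1}

/-- The rightward cone at `z`. -/
def rightCone (z : ℤ × ℤ) : Set (ℤ × ℤ) := {p | p.2 - p.1 ≤ z.2 - z.1 ∧ z.2 + z.1 ≤ p.2 + p.1}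

theorem IsCone.image {C : Set (ℤ × ℤ)} (h : IsCone C) (φ : lattice ≃g lattice) :
    IsCone (φ '' C) := by
  obtain ⟨ψ, rfl⟩ := h
  exact ⟨ψ.trans φ, by rw [← Set.image_comp]; rfl⟩

theorem isCone_upCone (z : ℤ × ℤ) : IsCone (upCone z) := by
  refine ⟨translation z, ?_⟩
  ext ⟨x, y⟩
  rw [mem_translation_image]
  simp only [standardCone, upCone, Set.mem_ofPred_eq]
  omega

theorem isCone_rightCone (z : ℤ × ℤ) : IsCone (rightCone z) := by
  convert (isCone_upCone z.swap).image transposition using 1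
  ext ⟨x, y⟩
  rw [mem_transposition_image]
  simp only [rightCone, upCone, Set.mem_ofPred_eq, Prod.fst_swap, Prod.snd_swap]
  omega

theorem isCone_leftCone (z : ℤ × ℤ) : IsCone (leftCone z) := by
  convert (isCone_rightCone (-z.1, z.2)).image reflection using 1
  ext ⟨x, y⟩
  rw [mem_reflection_image]
  simp only [rightCone, leftCone, Set.mem_ofPred_eq]
  omega

theorem isCone_downCone (z : ℤ × ℤ) : IsCone (downCone z) := by
  convert (isCone_leftCone z.swap).image transposition using 1
  ext ⟨x, y⟩
  rw [mem_transposition_image]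
  simp only [downCone, leftCone, Set.mem_ofPred_eq, Prod.fst_swap, Prod.snd_swap]
  omega

/-- There are only four orientations, and a cone contains the equally oriented cone at each of its
points. This reduces unions of cones to a condition on apexes. -/
theorem IsCone.exists_subset {C : Set (ℤ × ℤ)} (h : IsCone C) {z : ℤ × ℤ} (hz : z ∈ C) :
    upCone z ⊆ C ∨ downCone z ⊆ C ∨ leftCone z ⊆ C ∨ rightCone z ⊆ C := by
  obtain ⟨φ, rfl⟩ := h
  obtain ⟨⟨t₁, t₂⟩, a, b, hφ, hab⟩ := exists_iso_eq φ
  obtain ⟨⟨x, y⟩, hxy, rfl⟩ := hz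
  have main : ∀ C : Set (ℤ × ℤ), (∀ p ∈ C, ∃ x' y', φ (x', y') = p ∧ 0 ≤ y' - x' ∧ 0 ≤ y' + x') →
      C ⊆ φ '' standardCone := fun C h p hp => by
    obtain ⟨x', y', rfl, h⟩ := h p hp
    exact ⟨_, h, rfl⟩
  simp only [standardCone, Set.mem_ofPred_eq] at hxy
  rcases hab with ⟨rfl | rfl, rfl | rfl⟩ | ⟨rfl | rfl, rfl | rfl⟩ <;>
    simp only [hφ, Prod.smul_mk, Prod.mk_add_mk, smul_eq_mul, mul_one, mul_zero, mul_neg,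
      add_zero] at main ⊢
  · refine .inl (main _ fun p hp => ⟨p.1 - t₁, p.2 - t₂, ?_⟩)
    simp only [upCone, Set.mem_ofPred_eq] at hp
    exact ⟨Prod.ext (by simp) (by simp), by omega, by omega⟩
  · refine .inr (.inl (main _ fun p hp => ⟨p.1 - t₁, t₂ - p.2, ?_⟩))
    simp only [downCone, Set.mem_ofPred_eq] at hp
    exact ⟨Prod.ext (by simp) (by simp), by omega, by omega⟩
  · refine .inl (main _ fun p hp => ⟨t₁ - p.1, p.2 - t₂, ?_⟩)
    simp only [upCone, Set.mem_ofPred_eq] at hp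
    exact ⟨Prod.ext (by simp) (by simp), by omega, by omega⟩
  · refine .inr (.inl (main _ fun p hp => ⟨t₁ - p.1, t₂ - p.2, ?_⟩))
    simp only [downCone, Set.mem_ofPred_eq] at hp
    exact ⟨Prod.ext (by simp) (by simp), by omega, by omega⟩
  · refine .inr (.inr (.inr (main _ fun p hp => ⟨p.2 - t₂, p.1 - t₁, ?_⟩)))
    simp only [rightCone, Set.mem_ofPred_eq] at hp
    exact ⟨Prod.ext (by simp) (by simp), by omega, by omega⟩
  · refine .inr (.inr (.inl (main _ fun p hp => ⟨p.2 - t₂, t₁ - p.1, ?_⟩)))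
    simp only [leftCone, Set.mem_ofPred_eq] at hp
    exact ⟨Prod.ext (by simp) (by simp), by omega, by omega⟩
  · refine .inr (.inr (.inr (main _ fun p hp => ⟨t₂ - p.2, p.1 - t₁, ?_⟩)))
    simp only [rightCone, Set.mem_ofPred_eq] at hp
    exact ⟨Prod.ext (by simp) (by simp), by omega, by omega⟩
  · refine .inr (.inr (.inl (main _ fun p hp => ⟨t₂ - p.2, t₁ - p.1, ?_⟩)))
    simp only [leftCone, Set.mem_ofPred_eq] at hp
    exact ⟨Prod.ext (by simp) (by simp), by omega, by omega⟩

/-! ### Complements that are unions of cones -/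

/-- Every point off `A` is the apex of a cone avoiding `A`. -/
def ConeConvex (A : Set (ℤ × ℤ)) : Prop :=
  ∀ z ∉ A, Disjoint (upCone z) A ∨ Disjoint (downCone z) A ∨ Disjoint (leftCone z) A ∨
    Disjoint (rightCone z) A

theorem isUnionOfCones_compl_iff : IsUnionOfCones Aᶜ ↔ ConeConvex A := by
  constructor
  · rintro ⟨F, hF, h⟩ z hz
    obtain ⟨C, hC, hzC⟩ : z ∈ ⋃₀ F := h ▸ hz
    have hCA : Disjoint C A :=
      Set.disjoint_left.2 fun p hp => show p ∈ Aᶜ from h ▸ Set.mem_sUnion_of_mem hp hC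
    exact ((hF C hC).exists_subset hzC).imp hCA.mono_left
      (.imp hCA.mono_left (.imp hCA.mono_left hCA.mono_left))
  · intro h
    refine ⟨{C | IsCone C ∧ Disjoint C A}, fun C hC => hC.1, ?_⟩
    refine Set.Subset.antisymm (fun z hz => ?_)
      (Set.sUnion_subset fun C hC => hC.2.subset_compl_right)
    rcases h z hz with h | h | h | h
    · exact ⟨_, ⟨isCone_upCone z, h⟩, by simp [upCone]⟩
    · exact ⟨_, ⟨isCone_downCone z, h⟩, by simp [downCone]⟩
    · exact ⟨_, ⟨isCone_leftCone z, h⟩, by simp [leftCone]⟩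
    · exact ⟨_, ⟨isCone_rightCone z, h⟩, by simp [rightCone]⟩

set_option maxHeartbeats 1000000 in
/-- If `A` misses a cone at each point off `A`, then pushing the points of `∂A` along the axes of
these cones to the border of the enclosing box is injective. -/
theorem ConeConvex.ncard_boundary_le (hA : ConeConvex A) (hc : Corners A nw ne sw se) :
    (boundary lattice A).ncard ≤ (boundary lattice (enc A)).ncard := by
  rw [hc.enc_eq]
  obtain ⟨a, ha⟩ : ∃ a, a = se.2 - se.1 := ⟨_, rfl⟩
  obtain ⟨b, hb⟩ : ∃ b, b = nw.2 - nw.1 := ⟨_, rfl⟩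
  obtain ⟨c, hc'⟩ : ∃ c, c = sw.2 + sw.1 := ⟨_, rfl⟩
  obtain ⟨d, hd⟩ : ∃ d, d = ne.2 + ne.1 := ⟨_, rfl⟩
  rw [← ha, ← hb, ← hc', ← hd]
  have hbox : ∀ {x y}, (x, y) ∈ A → (a ≤ y - x ∧ y - x ≤ b) ∧ (c ≤ y + x ∧ y + x ≤ d) := fun h =>
    ⟨⟨ha ▸ hc.se_le h, hb ▸ hc.le_nw h⟩, ⟨hc' ▸ hc.sw_le h, hd ▸ hc.le_ne h⟩⟩
  have hnbr : ∀ z ∈ boundary lattice A, ∃ x y, (x, y) ∈ A ∧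
      (y - x = z.2 - z.1 + 1 ∨ y - x = z.2 - z.1 - 1) ∧
      (y + x = z.2 + z.1 + 1 ∨ y + x = z.2 + z.1 - 1) := by
    rintro ⟨x, y⟩ h
    obtain ⟨-, h | h | h | h⟩ := mem_boundary.1 h <;> exact ⟨_, _, h, by simp only; omega⟩
  -- The signs `σ` and `τ` encode the orientation of a free cone in the coordinates `y - x` and `y +
  -- x`; its axis is the direction `(σ, τ)`.
  have hcone : ∀ z ∈ boundary lattice A, ∃ σ τ : ℤ, (σ = 1 ∨ σ = -1) ∧ (τ = 1 ∨ τ = -1) ∧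
      ∀ {x y}, (x, y) ∈ A → ¬(0 ≤ σ * (y - x - (z.2 - z.1)) ∧ 0 ≤ τ * (y + x - (z.2 + z.1))) := by
    intro z hz
    rcases hA z hz.1 with h | h | h | h
    · refine ⟨1, 1, .inl rfl, .inl rfl, fun hp h' => Set.disjoint_right.1 h hp ?_⟩
      simp only [upCone, Set.mem_ofPred_eq]
      omega
    · refine ⟨-1, -1, .inr rfl, .inr rfl, fun hp h' => Set.disjoint_right.1 h hp ?_⟩
      simp only [downCone, Set.mem_ofPred_eq]
      omega
    · refine ⟨1, -1, .inl rfl, .inr rfl, fun hp h' => Set.disjoint_right.1 h hp ?_⟩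
      simp only [leftCone, Set.mem_ofPred_eq]
      omega
    · refine ⟨-1, 1, .inr rfl, .inl rfl, fun hp h' => Set.disjoint_right.1 h hp ?_⟩
      simp only [rightCone, Set.mem_ofPred_eq]
      omega
  choose! X Y hXY using hnbr
  choose! σ τ hσ hτ hfree using hcone
  have hpush : ∀ z ∈ boundary lattice A, ∃ m ∈ boundary lattice (box a b c d), ∃ t : ℤ, 0 ≤ t ∧
      m.2 - m.1 = z.2 - z.1 + σ z * t ∧ m.2 + m.1 = z.2 + z.1 + τ z * t := by
    intro z hz
    obtain ⟨hXA, h1, h2⟩ := hXY z hz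
    have h3 := hfree z hz hXA
    have h4 := hbox hXA
    have mem : ∀ x y x' y' : ℤ, (x', y') ∈ box a b c d → (x, y) ∉ box a b c d →
        (x' = x + 1 ∧ y' = y ∨ x' = x - 1 ∧ y' = y ∨ x' = x ∧ y' = y + 1 ∨ x' = x ∧ y' = y - 1) →
        (x, y) ∈ boundary lattice (box a b c d) := by
      rintro x y x' y' h h' (⟨rfl, rfl⟩ | ⟨rfl, rfl⟩ | ⟨rfl, rfl⟩ | ⟨rfl, rfl⟩)
      · exact mem_boundary.2 ⟨h', .inl h⟩
      · exact mem_boundary.2 ⟨h', .inr (.inl h)⟩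
      · exact mem_boundary.2 ⟨h', .inr (.inr (.inl h))⟩
      · exact mem_boundary.2 ⟨h', .inr (.inr (.inr h))⟩
    have hmin : ∀ p q : ℤ, ∃ k, k ≤ p ∧ k ≤ q ∧ (k = p ∨ k = q) := fun p q => ⟨min p q, by omega⟩
    -- A point inside the box moves to the first point of the axis outside it, whence the minimum of
    -- two distances; a point already outside stays put.
    by_cases hz' : z ∈ box a b c d
    · have hz'' := hz'
      simp only [box, Set.mem_ofPred_eq] at hz''
      rcases hσ z hz with h5 | h5 <;> rcases hτ z hz with h6 | h6 <;> rw [h5, h6]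
      · obtain ⟨k, hk⟩ := hmin (b + 1 - (z.2 - z.1)) (d + 1 - (z.2 + z.1))
        refine ⟨(z.1, z.2 + k), mem _ _ z.1 (z.2 + k - 1) ?_ ?_ (by omega), k, ?_⟩ <;>
          simp only [box, Set.mem_ofPred_eq] <;> omega
      · obtain ⟨k, hk⟩ := hmin (b + 1 - (z.2 - z.1)) (z.2 + z.1 - (c - 1))
        refine ⟨(z.1 - k, z.2), mem _ _ (z.1 - k + 1) z.2 ?_ ?_ (by omega), k, ?_⟩ <;>
          simp only [box, Set.mem_ofPred_eq] <;> omega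
      · obtain ⟨k, hk⟩ := hmin (z.2 - z.1 - (a - 1)) (d + 1 - (z.2 + z.1))
        refine ⟨(z.1 + k, z.2), mem _ _ (z.1 + k - 1) z.2 ?_ ?_ (by omega), k, ?_⟩ <;>
          simp only [box, Set.mem_ofPred_eq] <;> omega
      · obtain ⟨k, hk⟩ := hmin (z.2 - z.1 - (a - 1)) (z.2 + z.1 - (c - 1))
        refine ⟨(z.1, z.2 - k), mem _ _ z.1 (z.2 - k + 1) ?_ ?_ (by omega), k, ?_⟩ <;>
          simp only [box, Set.mem_ofPred_eq] <;> omega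
    · exact ⟨z, mem _ _ (X z) (Y z) h4 hz' (by omega), 0, le_rfl, by simp, by simp⟩
  choose! m hm t ht hu hv using hpush
  have hrect : ∀ z ∈ boundary lattice A, (a - 1 ≤ (m z).2 - (m z).1 ∧ (m z).2 - (m z).1 ≤ b + 1) ∧
      (c - 1 ≤ (m z).2 + (m z).1 ∧ (m z).2 + (m z).1 ≤ d + 1) := by
    intro z hz
    have h := mem_boundary.1 (hm z hz)
    simp only [box, Set.mem_ofPred_eq] at h
    omega
  refine Set.ncard_le_ncard_of_injOn m hm ?_ (finite_boundary (finite_box _ _ _ _))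
  intro z hz w hw heq
  have z1 := hXY z hz
  have w1 := hXY w hw
  have z2 := hfree z hz z1.1
  have z3 := hfree w hw z1.1
  have w2 := hfree z hz w1.1
  have w3 := hfree w hw w1.1
  have z4 := hu z hz
  have w4 := hu w hw
  have z5 := hv z hz
  have w5 := hv w hw
  have z6 := ht z hz
  have w6 := ht w hw
  have hr := hrect z hz
  have n1 := hfree z hz hc.nw_mem
  have n2 := hfree w hw hc.nw_mem
  have n3 := hfree z hz hc.se_mem
  have n4 := hfree w hw hc.se_mem
  have n5 := hfree z hz hc.ne_mem
  have n6 := hfree w hw hc.ne_mem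
  have n7 := hfree z hz hc.sw_mem
  have n8 := hfree w hw hc.sw_mem
  rw [← heq] at w4 w5
  replace z1 := z1.2
  replace w1 := w1.2
  rw [Prod.ext_iff]
  rcases hσ z hz with h1 | h1 <;> rcases hτ z hz with h2 | h2 <;>
    rcases hσ w hw with h3 | h3 <;> rcases hτ w hw with h4 | h4 <;>
    rw [h1] at z2 w2 z4 n1 n3 n5 n7 <;> rw [h2] at z2 w2 z5 n1 n3 n5 n7 <;>
    rw [h3] at z3 w3 w4 n2 n4 n6 n8 <;> rw [h4] at z3 w3 w5 n2 n4 n6 n8 <;>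
    clear h1 h2 h3 h4 hfree hσ hτ hu hv ht hrect hm hXY
  -- Suppose two points share an image. Unless they coincide, one lies strictly inside the free cone
  -- of the other, which then contains its neighbour in `A`, or they moved equally far in
  -- perpendicular directions; then the two cones together cover a half-plane containing a corner of
  -- `A`.
  all_goals
    rcases lt_trichotomy (t z) (t w) with hlt | hlt | hlt <;> first
    | (clear n1 n2 n3 n4 n5 n6 n7 n8 w1 w2 w3 hr; omega)
    | (clear n1 n2 n3 n4 n5 n6 n7 n8 z1 z2 z3 hr; omega)
    | (clear z1 z2 z3 w1 w2 w3 n3 n4 n5 n6 n7 n8; omega)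
    | (clear z1 z2 z3 w1 w2 w3 n1 n2 n5 n6 n7 n8; omega)
    | (clear z1 z2 z3 w1 w2 w3 n1 n2 n3 n4 n7 n8; omega)
    | (clear z1 z2 z3 w1 w2 w3 n1 n2 n3 n4 n5 n6; omega)

/-! ### Free cones at the sides of a minimal set -/

/-- Climb row by row. The point below a first intruder is a boundary point, hence a side point, and
each of the four sides is impossible: left and right by induction, bottom by the quadrant lemma, top
by the intruder itself. -/
theorem IsMinimal.notMem_upper_leftCone (hA : IsMinimal A) (hc : Corners A nw ne sw se) {x y : ℤ}
    (hl : ∀ a ≤ x, (a, y) ∉ A) (hs : sw.2 ≤ y) (j : ℕ) {k : ℤ} (hk : j ≤ k) :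
    (x - k, y + j) ∉ A := by
  induction j generalizing k with
  | zero =>
    rw [Nat.cast_zero, add_zero]
    exact hl _ (by omega)
  | succ j ih =>
    push_cast at hk ⊢
    intro hmem
    have he : (x - k, y + j) ∈ boundary lattice A :=
      mem_boundary.2 ⟨ih (by omega), .inr (.inr (.inl (by rwa [add_assoc])))⟩
    rw [← hA.boundary_eq_sides hc] at he
    rcases he with (⟨-, -, h⟩ | ⟨-, -, h⟩) | ⟨⟨h1, -⟩, h2, -⟩ | ⟨-, h, -⟩
    · exact ih (k := k - 1) (by omega) (by convert h using 2; ring)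
    · exact ih (k := k + 1) (by omega) (by convert h using 2; ring)
    · have := hA.subset_lowerLeft (x₀ := x - k) (y₀ := y) (fun a ha => hl a (by omega))
        (fun b hb => h2 b (by simp only; omega)) hc.sw_mem h1 hs hmem
      omega
    · exact h (y + (j + 1)) (by simp only; omega) hmem

theorem IsMinimal.notMem_lower_leftCone (hA : IsMinimal A) (hc : Corners A nw ne sw se) {x y : ℤ}
    (hl : ∀ a ≤ x, (a, y) ∉ A) (hn : y ≤ nw.2) (j : ℕ) {k : ℤ} (hk : j ≤ k) :
    (x - k, y - j) ∉ A := by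
  -- This composite is `(x, y) ↦ (x, -y)`, which exchanges the upper and lower halves of a leftward
  -- cone.
  let φ : lattice ≃g lattice := (transposition.trans reflection).trans transposition
  have mem : ∀ {a b}, (a, b) ∈ φ '' A ↔ (a, -b) ∈ A := by
    intro a b
    rw [show φ '' A = transposition '' (reflection '' (transposition '' A)) by
      rw [← Set.image_comp, ← Set.image_comp]; rfl]
    rw [mem_transposition_image, mem_reflection_image, mem_transposition_image]
  have hφ := hc.transposition.reflection.transposition
  rw [show transposition '' (reflection '' (transposition '' A)) = φ '' A by
    rw [← Set.image_comp, ← Set.image_comp]; rfl] at hφ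
  have h := (hA.image φ).notMem_upper_leftCone hφ (x := x) (y := -y)
    (fun a ha => by rw [mem, neg_neg]; exact hl a ha) (by simp; omega) j hk
  rwa [mem, neg_add, neg_neg, ← sub_eq_add_neg] at h

theorem IsMinimal.disjoint_leftCone (hA : IsMinimal A) (hc : Corners A nw ne sw se) {w : ℤ × ℤ}
    (hw : w ∈ leftSide A nw sw) : Disjoint (leftCone w) A := by
  obtain ⟨x, y⟩ := w
  rw [Set.disjoint_left]
  rintro ⟨a, b⟩ hab
  simp only [leftCone, Set.mem_ofPred_eq] at hab
  obtain ⟨⟨h1, h2⟩, h3, -⟩ := hw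
  rcases le_total y b with h | h
  · have := hA.notMem_upper_leftCone hc h3 h1 (b - y).toNat (k := x - a) (by omega)
    rw [Int.toNat_of_nonneg (by omega)] at this
    simpa using this
  · have := hA.notMem_lower_leftCone hc h3 h2 (y - b).toNat (k := x - a) (by omega)
    rw [Int.toNat_of_nonneg (by omega)] at this
    simpa using this

theorem IsMinimal.disjoint_rightCone (hA : IsMinimal A) (hc : Corners A nw ne sw se) {w : ℤ × ℤ}
    (hw : w ∈ rightSide A ne se) : Disjoint (rightCone w) A := by
  obtain ⟨x, y⟩ := w
  have h := (hA.image reflection).disjoint_leftCone hc.reflection (mem_rightSide_iff.1 hw)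
  rw [Set.disjoint_left] at h ⊢
  rintro ⟨a, b⟩ hab hA'
  refine h (a := (-a, b)) ?_ (mem_reflection_image.2 (by simpa using hA'))
  simp only [leftCone, rightCone, Set.mem_ofPred_eq] at hab ⊢
  omega

theorem IsMinimal.disjoint_downCone (hA : IsMinimal A) (hc : Corners A nw ne sw se) {w : ℤ × ℤ}
    (hw : w ∈ bottomSide A sw se) : Disjoint (downCone w) A := by
  obtain ⟨x, y⟩ := w
  have h := (hA.image transposition).disjoint_leftCone hc.transposition (mem_bottomSide_iff.1 hw)
  rw [Set.disjoint_left] at h ⊢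
  rintro ⟨a, b⟩ hab hA'
  refine h (a := (b, a)) ?_ (mem_transposition_image.2 hA')
  simp only [leftCone, downCone, Set.mem_ofPred_eq] at hab ⊢
  omega

theorem IsMinimal.disjoint_upCone (hA : IsMinimal A) (hc : Corners A nw ne sw se) {w : ℤ × ℤ}
    (hw : w ∈ topSide A nw ne) : Disjoint (upCone w) A := by
  obtain ⟨x, y⟩ := w
  have h := (hA.image transposition).disjoint_rightCone hc.transposition (mem_topSide_iff.1 hw)
  rw [Set.disjoint_left] at h ⊢
  rintro ⟨a, b⟩ hab hA'
  refine h (a := (b, a)) ?_ (mem_transposition_image.2 hA')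
  simp only [rightCone, upCone, Set.mem_ofPred_eq] at hab ⊢
  omega

/-! ### A minimal set equals its cone hull -/

/-- The points such that all four cones at the point meet `A`. -/
def coneHull (A : Set (ℤ × ℤ)) : Set (ℤ × ℤ) :=
  {z | ¬(Disjoint (upCone z) A ∨ Disjoint (downCone z) A ∨ Disjoint (leftCone z) A ∨
    Disjoint (rightCone z) A)}

theorem subset_coneHull : A ⊆ coneHull A := by
  rintro z hz (h | h | h | h)
  · exact Set.disjoint_right.1 h hz (by simp [upCone])
  · exact Set.disjoint_right.1 h hz (by simp [downCone])
  · exact Set.disjoint_right.1 h hz (by simp [leftCone])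
  · exact Set.disjoint_right.1 h hz (by simp [rightCone])

theorem coneConvex_coneHull : ConeConvex (coneHull A) := by
  intro z hz
  refine (not_not.1 hz).imp ?_ (.imp ?_ (.imp ?_ ?_)) <;> refine fun h =>
    Set.disjoint_left.2 fun w hw hwA => hwA ?_
  · refine .inl (h.mono_left fun p hp => ?_)
    simp only [upCone, Set.mem_ofPred_eq] at *
    omega
  · refine .inr (.inl (h.mono_left fun p hp => ?_))
    simp only [downCone, Set.mem_ofPred_eq] at *
    omega
  · refine .inr (.inr (.inl (h.mono_left fun p hp => ?_)))
    simp only [leftCone, Set.mem_ofPred_eq] at *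
    omega
  · refine .inr (.inr (.inr (h.mono_left fun p hp => ?_)))
    simp only [rightCone, Set.mem_ofPred_eq] at *
    omega

theorem Corners.coneHull (hc : Corners A nw ne sw se) :
    Corners (coneHull A) nw ne sw se where
  nw_mem := subset_coneHull hc.nw_mem
  ne_mem := subset_coneHull hc.ne_mem
  sw_mem := subset_coneHull hc.sw_mem
  se_mem := subset_coneHull hc.se_mem
  le_nw {x y} h := by
    by_contra hlt
    refine h (.inl (Set.disjoint_left.2 ?_))
    rintro ⟨a, b⟩ hp hA
    have := hc.le_nw hA
    simp only [upCone, Set.mem_ofPred_eq] at hp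
    omega
  le_ne {x y} h := by
    by_contra hlt
    refine h (.inl (Set.disjoint_left.2 ?_))
    rintro ⟨a, b⟩ hp hA
    have := hc.le_ne hA
    simp only [upCone, Set.mem_ofPred_eq] at hp
    omega
  sw_le {x y} h := by
    by_contra hlt
    refine h (.inr (.inl (Set.disjoint_left.2 ?_)))
    rintro ⟨a, b⟩ hp hA
    have := hc.sw_le hA
    simp only [downCone, Set.mem_ofPred_eq] at hp
    omega
  se_le {x y} h := by
    by_contra hlt
    refine h (.inr (.inl (Set.disjoint_left.2 ?_)))
    rintro ⟨a, b⟩ hp hA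
    have := hc.se_le hA
    simp only [downCone, Set.mem_ofPred_eq] at hp
    omega

theorem Corners.finite (hc : Corners A nw ne sw se) : A.Finite :=
  (finite_box _ _ _ _).subset (hc.enc_eq ▸ subset_enc)

/-- Side points are apexes of free cones, so `∂A` stays outside the hull and in its boundary. The
hull is cone convex with the same enclosing box, so its boundary has at most `|∂(enc A)| = |∂A|`
points. -/
theorem IsMinimal.boundary_coneHull (hA : IsMinimal A) (hc : Corners A nw ne sw se) :
    boundary lattice (coneHull A) = boundary lattice A := by
  symm
  refine Set.eq_of_subset_of_ncard_le ?_ ?_ (finite_boundary hc.coneHull.finite)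
  · rintro w hw
    refine ⟨fun h => h ?_, hw.2.imp fun v hv => ⟨subset_coneHull hv.1, hv.2⟩⟩
    rw [← hA.boundary_eq_sides hc] at hw
    rcases hw with (h | h) | h | h
    · exact .inr (.inr (.inl (hA.disjoint_leftCone hc h)))
    · exact .inr (.inr (.inr (hA.disjoint_rightCone hc h)))
    · exact .inr (.inl (hA.disjoint_downCone hc h))
    · exact .inl (hA.disjoint_upCone hc h)
  · have h := coneConvex_coneHull.ncard_boundary_le hc.coneHull
    rw [hc.coneHull.enc_eq, ← hc.enc_eq] at h
    rwa [← hA.ncard_boundary_eq_enc ⟨_, hc.nw_mem⟩] at h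

/-- Walking from a point of `coneHull A \ A` in a fixed direction, one leaves `coneHull A` at a
boundary point of `A`. -/
theorem IsMinimal.exists_exit (hA : IsMinimal A) (hc : Corners A nw ne sw se) {z e : ℤ × ℤ}
    (hz : z ∈ coneHull A \ A) (he : ∀ w, lattice.Adj w (w + e)) (he0 : e ≠ 0) :
    ∃ j : ℕ, z + (j + 1 : ℤ) • e ∈ boundary lattice A ∧ z + (j : ℤ) • e ∉ A := by
  have hex : ∃ j : ℕ, z + (j : ℤ) • e ∉ coneHull A := by
    by_contra! hcon
    have hinj : Function.Injective fun j : ℕ => z + (j : ℤ) • e := fun i j h => by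
      have := smul_left_injective ℤ he0 (add_left_cancel h)
      exact_mod_cast this
    exact Set.infinite_of_injective_forall_mem hinj hcon hc.coneHull.finite
  classical
  have hmin := fun j => Nat.find_min hex (m := j)
  have hspec := Nat.find_spec hex
  obtain ⟨j, hj⟩ : ∃ j, Nat.find hex = j + 1 := Nat.exists_eq_succ_of_ne_zero fun h => by
    rw [h] at hspec
    exact hspec (by simpa using hz.1)
  rw [hj] at hmin hspec
  have step : ∀ i : ℕ, z + (i : ℤ) • e + e = z + ((i + 1 : ℕ) : ℤ) • e := fun i => by
    push_cast
    rw [add_smul, one_smul, add_assoc]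
  have hadj : ∀ i : ℕ, lattice.Adj (z + ((i + 1 : ℕ) : ℤ) • e) (z + (i : ℤ) • e) := fun i => by
    rw [← step]
    exact (he _).symm
  -- Just before entering `A` the walk would be at a point of `∂A`, which is also the boundary of
  -- the hull, while still inside the hull.
  have hnot : ∀ i ≤ j, z + (i : ℤ) • e ∉ A := by
    intro i hi
    induction i with
    | zero => simpa using hz.2
    | succ i ih =>
      intro h
      have h1 := hmin i (by omega)
      rw [not_not] at h1
      have : z + (i : ℤ) • e ∈ boundary lattice A := ⟨ih (by omega), _, h, (hadj i).symm⟩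
      rw [← hA.boundary_coneHull hc] at this
      exact this.1 h1
  refine ⟨j, ?_, hnot j le_rfl⟩
  rw [← hA.boundary_coneHull hc]
  have h1 := hmin j (by omega)
  rw [not_not] at h1
  exact ⟨by exact_mod_cast hspec, _, h1, by exact_mod_cast hadj j⟩

/-- From a hull point off `A`, walks in the four axis directions end at side points. Free cones and
the quadrant lemma restrict which sides these are until only two cyclic patterns remain, and those
contradict the free cones. -/
theorem IsMinimal.coneHull_eq (hA : IsMinimal A) (hc : Corners A nw ne sw se) :
    coneHull A = A := by
  refine Set.Subset.antisymm (fun z hz => ?_) subset_coneHull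
  by_contra hzA
  obtain ⟨x, y⟩ := z
  have hzh : (x, y) ∈ coneHull A \ A := ⟨hz, hzA⟩
  simp only [coneHull, Set.mem_ofPred_eq, not_or] at hz
  obtain ⟨hup, hdown, hleft, hright⟩ := hz
  obtain ⟨i, hi, hi'⟩ := hA.exists_exit hc (e := (0, 1)) hzh
    (fun w => (adj_iff _ _).2 (by simp [Prod.ext_iff])) (by simp)
  obtain ⟨j, hj, hj'⟩ := hA.exists_exit hc (e := (0, -1)) hzh
    (fun w => (adj_iff _ _).2 (by simp [Prod.ext_iff, sub_eq_add_neg])) (by simp)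
  obtain ⟨k, hk, hk'⟩ := hA.exists_exit hc (e := (-1, 0)) hzh
    (fun w => (adj_iff _ _).2 (by simp [Prod.ext_iff, sub_eq_add_neg])) (by simp)
  obtain ⟨l, hl, hl'⟩ := hA.exists_exit hc (e := (1, 0)) hzh
    (fun w => (adj_iff _ _).2 (by simp [Prod.ext_iff])) (by simp)
  simp only [Prod.smul_mk, Prod.mk_add_mk, smul_eq_mul, mul_one, mul_zero, mul_neg,
      add_zero] at hi hi' hj hj' hk hk' hl hl'
  rw [← hA.boundary_eq_sides hc] at hi hj hk hl
  -- upwards and downwards one meets the left or right side, sideways the bottom or top side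
  replace hi : (x, y + (i + 1)) ∈ leftSide A nw sw ∪ rightSide A ne se := by
    rcases hi with hi | hi | hi
    · exact hi
    -- A free downward cone above `z` would contain the downward cone at `z`, putting `z` outside
    -- the hull.
    · refine absurd ((hA.disjoint_downCone hc hi).mono_left fun p hp => ?_) hdown
      simp only [downCone, Set.mem_ofPred_eq] at *
      omega
    · exact absurd hi.2.2 (by convert hi' using 3; simp only; ring)
  replace hj : (x, y + -(j + 1)) ∈ leftSide A nw sw ∪ rightSide A ne se := by
    rcases hj with hj | hj | hj
    · exact hj
    · exact absurd hj.2.2 (by convert hj' using 3; simp only; ring)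
    · refine absurd ((hA.disjoint_upCone hc hj).mono_left fun p hp => ?_) hup
      simp only [upCone, Set.mem_ofPred_eq] at *
      omega
  replace hk : (x + -(k + 1), y) ∈ bottomSide A sw se ∪ topSide A nw ne := by
    rcases hk with (hk | hk) | hk
    · exact absurd hk.2.2 (by convert hk' using 3; simp only; ring)
    · refine absurd ((hA.disjoint_rightCone hc hk).mono_left fun p hp => ?_) hright
      simp only [rightCone, Set.mem_ofPred_eq] at *
      omega
    · exact hk
  replace hl : (x + (l + 1), y) ∈ bottomSide A sw se ∪ topSide A nw ne := by
    rcases hl with (hl | hl) | hl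
    · refine absurd ((hA.disjoint_leftCone hc hl).mono_left fun p hp => ?_) hleft
      simp only [leftCone, Set.mem_ofPred_eq] at *
      omega
    · exact absurd hl.2.2 (by convert hl' using 3; simp only; ring)
    · exact hl
  -- two adjacent exits cannot face the same quadrant
  have upperLeft : ¬((x, y + (i + 1)) ∈ leftSide A nw sw ∧
      (x + -(k + 1), y) ∈ topSide A nw ne) := by
    rintro ⟨⟨⟨-, h1⟩, h2, h3⟩, ⟨h4, -⟩, h5, -⟩
    have := hA.subset_upperLeft (fun a ha => h2 a (by simp only; omega))
      (fun b hb => h5 b (by simp only; omega)) hc.nw_mem h4 h1 h3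
    omega
  have upperRight : ¬((x, y + (i + 1)) ∈ rightSide A ne se ∧
      (x + (l + 1), y) ∈ topSide A nw ne) := by
    rintro ⟨⟨⟨-, h1⟩, h2, h3⟩, ⟨-, h4⟩, h5, -⟩
    have := hA.subset_upperRight (fun a ha => h2 a (by simp only; omega))
      (fun b hb => h5 b (by simp only; omega)) hc.ne_mem h4 h1 h3
    omega
  have lowerLeft : ¬((x, y + -(j + 1)) ∈ leftSide A nw sw ∧
      (x + -(k + 1), y) ∈ bottomSide A sw se) := by
    rintro ⟨⟨⟨h1, -⟩, h2, h3⟩, ⟨h4, -⟩, h5, -⟩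
    have := hA.subset_lowerLeft (fun a ha => h2 a (by simp only; omega))
      (fun b hb => h5 b (by simp only; omega)) hc.sw_mem h4 h1 h3
    omega
  have lowerRight : ¬((x, y + -(j + 1)) ∈ rightSide A ne se ∧
      (x + (l + 1), y) ∈ bottomSide A sw se) := by
    rintro ⟨⟨⟨h1, -⟩, h2, h3⟩, ⟨-, h4⟩, h5, -⟩
    have := hA.subset_lowerRight (fun a ha => h2 a (by simp only; omega))
      (fun b hb => h5 b (by simp only; omega)) hc.se_mem h4 h1 h3
    omega
  -- the two remaining configurations are pinwheels
  rcases hk with hk | hk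
  · have hj2 := hj.resolve_left fun h => lowerLeft ⟨h, hk⟩
    have hl2 := hl.resolve_left fun h => lowerRight ⟨hj2, h⟩
    have hi2 := hi.resolve_right fun h => upperRight ⟨h, hl2⟩
    -- The free cone at each exit must miss the point of `A` next to the following exit, so that
    -- exit is strictly closer to `z`; going once around gives a contradiction.
    have h1 := Set.disjoint_right.1 (hA.disjoint_downCone hc hk) hj2.2.2
    have h2 := Set.disjoint_right.1 (hA.disjoint_rightCone hc hj2) hl2.2.2
    have h3 := Set.disjoint_right.1 (hA.disjoint_upCone hc hl2) hi2.2.2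
    have h4 := Set.disjoint_right.1 (hA.disjoint_leftCone hc hi2) hk.2.2
    simp only [upCone, downCone, leftCone, rightCone, Set.mem_ofPred_eq] at h1 h2 h3 h4
    omega
  · have hi2 := hi.resolve_left fun h => upperLeft ⟨h, hk⟩
    have hl2 := hl.resolve_right fun h => upperRight ⟨hi2, h⟩
    have hj2 := hj.resolve_right fun h => lowerRight ⟨h, hl2⟩
    have h1 := Set.disjoint_right.1 (hA.disjoint_upCone hc hk) hi2.2.2
    have h2 := Set.disjoint_right.1 (hA.disjoint_rightCone hc hi2) hl2.2.2
    have h3 := Set.disjoint_right.1 (hA.disjoint_downCone hc hl2) hj2.2.2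
    have h4 := Set.disjoint_right.1 (hA.disjoint_leftCone hc hj2) hk.2.2
    simp only [upCone, downCone, leftCone, rightCone, Set.mem_ofPred_eq] at h1 h2 h3 h4
    omega

theorem IsMinimal.coneConvex (hA : IsMinimal A) (hne : A.Nonempty) : ConeConvex A := by
  obtain ⟨nw, ne, sw, se, hc⟩ := exists_corners hA.1 hne
  rw [← hA.coneHull_eq hc]
  exact coneConvex_coneHull

end LatticeIso

theorem theoremA (A : Set (ℤ × ℤ)) (hfin : A.Finite) (hne : A.Nonempty) :
    IsGreatest (LatticeIso.excessSet (LatticeIso.enc A))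
        (LatticeIso.excess (LatticeIso.enc A)) ∧
      List.TFAE
        [LatticeIso.IsMinimal A,
          (LatticeIso.boundary LatticeIso.lattice A).ncard =
              (LatticeIso.boundary LatticeIso.lattice (LatticeIso.enc A)).ncard ∧
            ((LatticeIso.enc A \ A).ncard : ℤ) ≤ LatticeIso.excess (LatticeIso.enc A),
          LatticeIso.IsUnionOfCones Aᶜ ∧
            ((LatticeIso.enc A \ A).ncard : ℤ) ≤ LatticeIso.excess (LatticeIso.enc A)] := by
  refine ⟨LatticeIso.isGreatest_excess (LatticeIso.finite_enc hfin hne)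
    (hne.mono LatticeIso.subset_enc), ?_⟩
  tfae_have 1 → 2 := fun h => ⟨h.ncard_boundary_eq_enc hne, h.ncard_enc_diff_le hne⟩
  tfae_have 2 → 1 := fun h => LatticeIso.isMinimal_of_ncard_boundary_le hfin hne h.1.le h.2
  tfae_have 1 → 3 := fun h =>
    ⟨LatticeIso.isUnionOfCones_compl_iff.2 (h.coneConvex hne), h.ncard_enc_diff_le hne⟩
  tfae_have 3 → 1 := fun h => by
    obtain ⟨nw, ne, sw, se, hc⟩ := LatticeIso.exists_corners hfin hne
    exact LatticeIso.isMinimal_of_ncard_boundary_le hfin hne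
      ((LatticeIso.isUnionOfCones_compl_iff.1 h.1).ncard_boundary_le hc) h.2
  tfae_finish
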